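/- Let $\tau>0$, let $H$ be a Hilbert space over $\mathbb K=\mathbb R$ or $\mathbb C$, and let $\Phi\in\mathcal L(H)$ with $\|\Phi\|_{\mathcal L(H)}\le 1$. Put $\mathcal H:=L^2(0,\tau;H)$. An operator $A$ in a normed space $X$ is called accretive if $\|x+tAx\|\ge\|x\|$ for all $x\in D(A)$ and $t>0$, and m-accretive if in addition $\lambda I+A\colon D(A)\to X$ is surjective for every $\lambda>0$. (a) Let $V$ be a Hilbert space over $\mathbb K$ that is continuously and densely embedded in $H$, let $V'$ be the space of bounded antilinear functionals on $V$, and identify $x\in H$ with the functional $w\mapsto (x\mid w)_H$, so that $V\hookrightarrow H\hookrightarrow V'$. Let $\mathfrak a\colon[0,\tau]\times V\times V\to\mathbb K$ be such that $\mathfrak a(t,\cdot,\cdot)$ is sesquilinear for all $t\in[0,\tau]$, $\mathfrak a(\cdot,v,w)$ is measurable for all $v,w\in V$, there is $M\ge 0$ with $|\mathfrak a(t,v,w)|\le M\|v\|_V\|w\|_V$ for all $t\in[0,\tau]$ and $v,w\in V$, and $\mathfrak a$ is coercive, i.e. there is $\alpha>0$ with $\operatorname{Re}\mathfrak a(t,v,v)\ge\alpha\|v\|_V^2$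 for all $t\in[0,\tau]$ and $v\in V$. Let $\mathcal A(t)\in\mathcal L(V,V')$ be given by $\langle\mathcal A(t)v,w\rangle=\mathfrak a(t,v,w)$. For $u\in L^2(0,\tau;V)$ let $\mathcal A(\cdot)u\in L^2(0,\tau;V')$ be the element $g$ such that for every $w\in V$ one has $\langle g(t),w\rangle=\mathfrak a(t,u(t),w)$ for almost every $t$ (if $V$ is separable, this means $g(t)=\mathcal A(t)u(t)$ for almost every $t$). Let $MR(V,V'):=H^1(0,\tau;V')\cap L^2(0,\tau;V)\subset C([0,\tau];H)$. Then the operator $C$ in $\mathcal H$ given by $$D(C):=\{u\in MR(V,V') : \dot u+\mathcal A(\cdot)u\in\mathcal H,\ u(0)=\Phi u(\tau)\},\qquad Cu:=\dot u+\mathcal A(\cdot)u,$$ is m-accretive. (b) The operator $B$ in $\mathcal H$ given by $$D(B):=\{u\in H^1(0,\tau;H) : u(0)=\Phi u(\tau)\},\qquad Bu:=u',$$ is m-accretive. -/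

import Mathlib

open MeasureTheory Set Filter Topology
open scoped ENNReal ContDiff InnerProductSpace

namespace TimeBVP

/-! ### Bochner spaces and weak derivatives on `(0, τ)` -/

/-- The Bochner space `L²(0, τ; X)`. -/
abbrev L2 (τ : ℝ) (X : Type*) [NormedAddCommGroup X] : Type _ :=
  Lp X 2 (volume.restrict (Ioo (0 : ℝ) τ))

/-- `u'` is the weak (distributional) derivative of `u` on `(0, τ)`: for every real test function
`φ ∈ C_c^∞(0, τ)` one has `∫ φ'(t) u(t) dt = - ∫ φ(t) u'(t) dt` (Bochner integrals in `X`). -/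
def HasWeakDeriv (τ : ℝ) {X : Type*} [NormedAddCommGroup X] [NormedSpace ℝ X]
    (u u' : ℝ → X) : Prop :=
  ∀ φ : ℝ → ℝ, ContDiff ℝ ∞ φ → HasCompactSupport φ → tsupport φ ⊆ Ioo 0 τ →
    ∫ t in Ioo 0 τ, deriv φ t • u t = -∫ t in Ioo 0 τ, φ t • u' t

section Boundary

variable {𝕜 : Type*} [RCLike 𝕜] {H : Type*} [NormedAddCommGroup H] [NormedSpace 𝕜 H]

/-- The time-boundary condition `u(0) = Φ u(τ)` for a class `u ∈ L²(0, τ; H)` that has a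
representative `w` which is continuous on `[0, τ]` (such a representative is unique on `[0, τ]`,
and its values are the values `u(0)` and `u(τ)`). -/
def TimeBoundary (τ : ℝ) (Φ : H →L[𝕜] H) (u : L2 τ H) : Prop :=
  ∃ w : ℝ → H, ContinuousOn w (Icc 0 τ) ∧ u =ᵐ[volume.restrict (Ioo 0 τ)] w ∧ w 0 = Φ (w τ)

end Boundary

/-! ### m-accretive operators -/

/-- An unbounded operator `A` in `X` is accretive if `‖x + t A x‖ ≥ ‖x‖` for all `x ∈ D(A)`, `t > 0`;
it is m-accretive if moreover `λ I + A : D(A) → X` is surjective for every `λ > 0`. -/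
structure IsMAccretive {𝕜 : Type*} [RCLike 𝕜] {X : Type*} [NormedAddCommGroup X] [NormedSpace 𝕜 X]
    (A : X →ₗ.[𝕜] X) : Prop where
  accretive : ∀ (x : A.domain) (t : ℝ), 0 < t → ‖(x : X)‖ ≤ ‖(x : X) + (t : 𝕜) • A x‖
  surjective : ∀ (l : ℝ), 0 < l → ∀ y : X, ∃ x : A.domain, (l : 𝕜) • (x : X) + A x = y

/-! ### Gelfand triple and non-autonomous forms -/

section Form

variable {𝕜 : Type*} [RCLike 𝕜]
  {V : Type*} [NormedAddCommGroup V] [InnerProductSpace 𝕜 V]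
  {H : Type*} [NormedAddCommGroup H] [InnerProductSpace 𝕜 H]

/-- The embedding `H → V'` of the Gelfand triple `V ↪ H ↪ V'` given by `ι : V → H`. Here `V'` is the
space `V →L⋆[𝕜] 𝕜` of bounded antilinear functionals, and `x ∈ H` is identified with the functional
`w ↦ (x | ι w)_H`, the scalar product being linear in `x` (Mathlib's `⟪ι w, x⟫`). -/
noncomputable def toAntiDual (ι : V →L[𝕜] H) : H →L[𝕜] (V →L⋆[𝕜] 𝕜) :=
  ((innerSL 𝕜).comp ι).flip

theorem toAntiDual_apply (ι : V →L[𝕜] H) (x : H) (w : V) : toAntiDual ι x w = ⟪ι w, x⟫_𝕜 := rfl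

/-- `a : [0, τ] × V × V → 𝕜` is a non-autonomous form: every `a t` is sesquilinear (linear in the
first, antilinear in the second variable), `t ↦ a t v w` is Lebesgue measurable on `[0, τ]` for all
`v, w`, and `|a t v w| ≤ M ‖v‖ ‖w‖` with `M` independent of `t ∈ [0, τ]`.
The values of `a t` for `t ∉ [0, τ]` play no role. -/
structure IsForm (τ : ℝ) (a : ℝ → V →ₗ[𝕜] V →ₗ⋆[𝕜] 𝕜) : Prop where
  measurable : ∀ v w : V, AEMeasurable (fun t => a t v w) (volume.restrict (Icc 0 τ))
  bounded : ∃ M : ℝ, 0 ≤ M ∧ ∀ t ∈ Icc 0 τ, ∀ v w : V, ‖a t v w‖ ≤ M * ‖v‖ * ‖w‖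

/-- The form is coercive (quasi-coercive with `ω = 0`). -/
def IsCoercive (τ : ℝ) (a : ℝ → V →ₗ[𝕜] V →ₗ⋆[𝕜] 𝕜) : Prop :=
  ∃ α : ℝ, 0 < α ∧ ∀ t ∈ Icc 0 τ, ∀ v : V, α * ‖v‖ ^ 2 ≤ RCLike.re (a t v v)

/-- `g ∈ L²(0, τ; V')` is `𝒜(·)v` for `v ∈ L²(0, τ; V)`, where `⟨𝒜(t)x, w⟩ = a(t, x, w)`: for every
`w ∈ V` one has `⟨g(t), w⟩ = a(t, v(t), w)` for almost every `t`. If `V` is separable this means that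
`g(t) = 𝒜(t)v(t)` in `V'` for almost every `t`, see `IsFormImage.ae_forall`. For a non-separable `V`,
where `t ↦ 𝒜(t)v(t)` may fail to be strongly measurable, it says that `g` is the functional
`w ↦ ∫ a(t, v(t), w(t)) dt` in `L²(0, τ; V)' = L²(0, τ; V')`. -/
def IsFormImage (τ : ℝ) (a : ℝ → V →ₗ[𝕜] V →ₗ⋆[𝕜] 𝕜) (v : L2 τ V) (g : L2 τ (V →L⋆[𝕜] 𝕜)) : Prop :=
  ∀ w : V, ∀ᵐ t ∂(volume.restrict (Ioo 0 τ)), g t w = a t (v t) w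

theorem IsFormImage.ae_forall [TopologicalSpace.SeparableSpace V] {τ : ℝ}
    {a : ℝ → V →ₗ[𝕜] V →ₗ⋆[𝕜] 𝕜} (ha : IsForm τ a) {v : L2 τ V} {g : L2 τ (V →L⋆[𝕜] 𝕜)}
    (h : IsFormImage τ a v g) :
    ∀ᵐ t ∂(volume.restrict (Ioo 0 τ)), ∀ w : V, g t w = a t (v t) w := by
  obtain ⟨M, -, hM⟩ := ha.bounded
  have h1 : ∀ᵐ t ∂(volume.restrict (Ioo 0 τ)), ∀ n : ℕ,
      g t (TopologicalSpace.denseSeq V n) = a t (v t) (TopologicalSpace.denseSeq V n) :=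
    ae_all_iff.2 fun n => h _
  filter_upwards [h1, ae_restrict_mem measurableSet_Ioo] with t ht htm w
  have hc : Continuous (a t (v t)) :=
    AddMonoidHomClass.continuous_of_bound (a t (v t)) (M * ‖v t‖)
      (hM t (Ioo_subset_Icc_self htm) (v t))
  have := (TopologicalSpace.denseRange_denseSeq V).equalizer (g t).continuous hc (funext ht)
  exact congrFun this w

/-- The relation `u ∈ MR(V, V') = H¹(0, τ; V') ∩ L²(0, τ; V)` together with its data: `v` is `u`
considered as an element of `L²(0, τ; V)`, and `d ∈ L²(0, τ; V')` is the weak derivative `u̇` of `u`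
considered as a function with values in `V'`. -/
structure IsMR (τ : ℝ) (ι : V →L[𝕜] H) (u : L2 τ H) (v : L2 τ V) (d : L2 τ (V →L⋆[𝕜] 𝕜)) : Prop where
  emb : (u : ℝ → H) =ᵐ[volume.restrict (Ioo 0 τ)] fun t => ι (v t)
  deriv : HasWeakDeriv τ (fun t => toAntiDual ι (u t)) d

end Form

/-! ### Linearity and uniqueness of weak derivatives -/

section WeakDeriv

variable {τ : ℝ} {X : Type*} [NormedAddCommGroup X] [NormedSpace ℝ X]

theorem integrable_smul_L2 {f : ℝ → X} (hf : MemLp f 2 (volume.restrict (Ioo 0 τ)))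
    {φ : ℝ → ℝ} (hφ : Continuous φ) (hc : HasCompactSupport φ) :
    Integrable (fun t => φ t • f t) (volume.restrict (Ioo 0 τ)) := by
  obtain ⟨C, hC⟩ := hc.exists_bound_of_continuous hφ
  exact (hf.integrable one_le_two).bdd_smul C hφ.aestronglyMeasurable (ae_of_all _ hC)

theorem HasWeakDeriv.congr {u v u' v' : ℝ → X} (h : HasWeakDeriv τ u u')
    (huv : u =ᵐ[volume.restrict (Ioo 0 τ)] v) (huv' : u' =ᵐ[volume.restrict (Ioo 0 τ)] v') :
    HasWeakDeriv τ v v' := by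
  intro φ h1 h2 h3
  have e1 : ∫ t in Ioo 0 τ, deriv φ t • v t = ∫ t in Ioo 0 τ, deriv φ t • u t :=
    integral_congr_ae (by filter_upwards [huv] with t ht; rw [ht])
  have e2 : ∫ t in Ioo 0 τ, φ t • v' t = ∫ t in Ioo 0 τ, φ t • u' t :=
    integral_congr_ae (by filter_upwards [huv'] with t ht; rw [ht])
  rw [e1, e2]
  exact h φ h1 h2 h3

theorem HasWeakDeriv.add {u v u' v' : ℝ → X} (h : HasWeakDeriv τ u u') (k : HasWeakDeriv τ v v')
    (hu : MemLp u 2 (volume.restrict (Ioo 0 τ))) (hv : MemLp v 2 (volume.restrict (Ioo 0 τ)))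
    (hu' : MemLp u' 2 (volume.restrict (Ioo 0 τ))) (hv' : MemLp v' 2 (volume.restrict (Ioo 0 τ))) :
    HasWeakDeriv τ (u + v) (u' + v') := by
  intro φ h1 h2 h3
  have cd : Continuous (deriv φ) := h1.continuous_deriv (by simp)
  simp only [Pi.add_apply, smul_add]
  rw [integral_add (integrable_smul_L2 hu cd h2.deriv) (integrable_smul_L2 hv cd h2.deriv),
    integral_add (integrable_smul_L2 hu' h1.continuous h2) (integrable_smul_L2 hv' h1.continuous h2),
    h φ h1 h2 h3, k φ h1 h2 h3, neg_add]

theorem HasWeakDeriv.smul {𝕜 : Type*} [RCLike 𝕜] [NormedSpace 𝕜 X] [SMulCommClass ℝ 𝕜 X]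
    {u u' : ℝ → X} (h : HasWeakDeriv τ u u') (c : 𝕜) : HasWeakDeriv τ (c • u) (c • u') := by
  intro φ h1 h2 h3
  simp only [Pi.smul_apply, smul_comm _ c]
  rw [integral_smul, integral_smul, h φ h1 h2 h3, smul_neg]

theorem HasWeakDeriv.eq_zero [CompleteSpace X] {u' : ℝ → X} (h : HasWeakDeriv τ 0 u')
    (hu' : MemLp u' 2 (volume.restrict (Ioo 0 τ))) : u' =ᵐ[volume.restrict (Ioo 0 τ)] 0 := by
  have hi : Integrable u' (volume.restrict (Ioo 0 τ)) := hu'.integrable one_le_two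
  have key := isOpen_Ioo.ae_eq_zero_of_integral_contDiff_smul_eq_zero (μ := volume)
    (U := Ioo 0 τ) (f := u') (IntegrableOn.locallyIntegrableOn hi) ?_
  · exact (ae_restrict_iff' measurableSet_Ioo).2 key
  · intro φ h1 h2 h3
    have e := h φ h1 h2 h3
    simp only [Pi.zero_apply, smul_zero, integral_zero] at e
    rw [← setIntegral_eq_integral_of_forall_compl_eq_zero (s := Ioo 0 τ), ← neg_eq_zero, ← e]
    intro t ht
    rw [image_eq_zero_of_notMem_tsupport (fun hh => ht (h3 hh)), zero_smul]

end WeakDeriv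

section BoundaryLinear

variable {𝕜 : Type*} [RCLike 𝕜] {H : Type*} [NormedAddCommGroup H] [NormedSpace 𝕜 H]
  {τ : ℝ} {Φ : H →L[𝕜] H}

theorem TimeBoundary.zero : TimeBoundary τ Φ (0 : L2 τ H) :=
  ⟨0, continuousOn_const, Lp.coeFn_zero _ _ _, by simp⟩

theorem TimeBoundary.add {u v : L2 τ H} (hu : TimeBoundary τ Φ u) (hv : TimeBoundary τ Φ v) :
    TimeBoundary τ Φ (u + v) := by
  obtain ⟨x, x1, x2, x3⟩ := hu
  obtain ⟨y, y1, y2, y3⟩ := hv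
  exact ⟨x + y, x1.add y1, (Lp.coeFn_add u v).trans (x2.add y2), by simp [x3, y3]⟩

theorem TimeBoundary.smul {u : L2 τ H} (hu : TimeBoundary τ Φ u) (c : 𝕜) :
    TimeBoundary τ Φ (c • u) := by
  obtain ⟨x, x1, x2, x3⟩ := hu
  exact ⟨c • x, x1.const_smul c, (Lp.coeFn_smul c u).trans (x2.const_smul c), by simp [x3]⟩

end BoundaryLinear

/-! ### The operator `C = d/dt + 𝒜(·)` -/

section OperatorC

variable {𝕜 : Type*} [RCLike 𝕜]
  {V : Type*} [NormedAddCommGroup V] [InnerProductSpace 𝕜 V]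
  {H : Type*} [NormedAddCommGroup H] [InnerProductSpace 𝕜 H]

/-- The graph of `C`: all pairs `(u, f)` in `L²(0, τ; H) × L²(0, τ; H)` with `u ∈ MR(V, V')`,
`u̇ + 𝒜(·)u = f` in `L²(0, τ; V')` and `u(0) = Φ u(τ)`. -/
def graphC (τ : ℝ) (ι : V →L[𝕜] H) (a : ℝ → V →ₗ[𝕜] V →ₗ⋆[𝕜] 𝕜) (Φ : H →L[𝕜] H) :
    Submodule 𝕜 (L2 τ H × L2 τ H) where
  carrier := {p | (∃ (v : L2 τ V) (d g : L2 τ (V →L⋆[𝕜] 𝕜)), IsMR τ ι p.1 v d ∧ IsFormImage τ a v g ∧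
    ∀ᵐ t ∂(volume.restrict (Ioo 0 τ)), d t + g t = toAntiDual ι (p.2 t)) ∧ TimeBoundary τ Φ p.1}
  zero_mem' := by
    refine ⟨⟨0, 0, 0, ⟨?_, ?_⟩, ?_, ?_⟩, TimeBoundary.zero⟩
    · filter_upwards [Lp.coeFn_zero H 2 (volume.restrict (Ioo 0 τ)),
        Lp.coeFn_zero V 2 (volume.restrict (Ioo 0 τ))] with t h1 h2
      simp only [Prod.fst_zero, h1, h2, Pi.zero_apply, map_zero]
    · have h0 : HasWeakDeriv τ (0 : ℝ → (V →L⋆[𝕜] 𝕜)) 0 := fun φ _ _ _ => by simp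
      refine h0.congr ?_ (Lp.coeFn_zero _ _ _).symm
      filter_upwards [Lp.coeFn_zero H 2 (volume.restrict (Ioo 0 τ))] with t h1
      simp only [Prod.fst_zero, h1, Pi.zero_apply, map_zero]
    · intro w
      filter_upwards [Lp.coeFn_zero (V →L⋆[𝕜] 𝕜) 2 (volume.restrict (Ioo 0 τ)),
        Lp.coeFn_zero V 2 (volume.restrict (Ioo 0 τ))] with t h1 h2
      rw [h1, h2, Pi.zero_apply, Pi.zero_apply, map_zero, LinearMap.zero_apply,
        _root_.zero_apply]
    · filter_upwards [Lp.coeFn_zero (V →L⋆[𝕜] 𝕜) 2 (volume.restrict (Ioo 0 τ)),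
        Lp.coeFn_zero H 2 (volume.restrict (Ioo 0 τ))] with t h1 h2
      simp only [Prod.snd_zero, h1, h2, Pi.zero_apply, map_zero, add_zero]
  add_mem' := by
    rintro ⟨u₁, f₁⟩ ⟨u₂, f₂⟩ ⟨⟨v₁, d₁, g₁, ⟨e₁, w₁⟩, i₁, q₁⟩, b₁⟩ ⟨⟨v₂, d₂, g₂, ⟨e₂, w₂⟩, i₂, q₂⟩, b₂⟩
    refine ⟨⟨v₁ + v₂, d₁ + d₂, g₁ + g₂, ⟨?_, ?_⟩, ?_, ?_⟩, b₁.add b₂⟩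
    · filter_upwards [e₁, e₂, Lp.coeFn_add u₁ u₂, Lp.coeFn_add v₁ v₂] with t h1 h2 h3 h4
      simp only [Prod.mk_add_mk, h3, h4, Pi.add_apply, map_add]
      rw [← h1, ← h2]
    · refine (w₁.add w₂ ((toAntiDual ι).comp_memLp' (Lp.memLp u₁))
        ((toAntiDual ι).comp_memLp' (Lp.memLp u₂)) (Lp.memLp d₁) (Lp.memLp d₂)).congr ?_
        (Lp.coeFn_add d₁ d₂).symm
      filter_upwards [Lp.coeFn_add u₁ u₂] with t h3
      simp only [Prod.mk_add_mk, h3, Pi.add_apply, map_add]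
    · intro w
      filter_upwards [i₁ w, i₂ w, Lp.coeFn_add g₁ g₂, Lp.coeFn_add v₁ v₂] with t h1 h2 h3 h4
      rw [h3, h4, Pi.add_apply, Pi.add_apply, map_add, LinearMap.add_apply,
        _root_.add_apply, h1, h2]
    · filter_upwards [q₁, q₂, Lp.coeFn_add d₁ d₂, Lp.coeFn_add g₁ g₂, Lp.coeFn_add f₁ f₂]
        with t h1 h2 h3 h4 h5
      simp only [Prod.mk_add_mk, h3, h4, h5, Pi.add_apply, map_add]
      rw [← h1, ← h2]
      abel
  smul_mem' := by
    rintro c ⟨u, f⟩ ⟨⟨v, d, g, ⟨e, w⟩, i, q⟩, b⟩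
    refine ⟨⟨c • v, c • d, c • g, ⟨?_, ?_⟩, ?_, ?_⟩, b.smul c⟩
    · filter_upwards [e, Lp.coeFn_smul c u, Lp.coeFn_smul c v] with t h1 h3 h4
      simp only [Prod.smul_mk, h3, h4, Pi.smul_apply, map_smul]
      rw [← h1]
    · refine (w.smul c).congr ?_ (Lp.coeFn_smul c d).symm
      filter_upwards [Lp.coeFn_smul c u] with t h3
      simp only [Prod.smul_mk, h3, Pi.smul_apply, map_smul]
    · intro w
      filter_upwards [i w, Lp.coeFn_smul c g, Lp.coeFn_smul c v] with t h1 h3 h4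
      simp [h1, h3, h4]
    · filter_upwards [q, Lp.coeFn_smul c d, Lp.coeFn_smul c g, Lp.coeFn_smul c f] with t h1 h3 h4 h5
      simp only [Prod.smul_mk, h3, h4, h5, Pi.smul_apply, map_smul]
      rw [← h1, smul_add]

/-- The operator `C = d/dt + 𝒜(·)` in `L²(0, τ; H)` with
`D(C) = {u ∈ MR(V, V') : u̇ + 𝒜(·)u ∈ L²(0, τ; H), u(0) = Φ u(τ)}`. -/
noncomputable def opC (τ : ℝ) (ι : V →L[𝕜] H) (a : ℝ → V →ₗ[𝕜] V →ₗ⋆[𝕜] 𝕜) (Φ : H →L[𝕜] H) :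
    L2 τ H →ₗ.[𝕜] L2 τ H :=
  (graphC τ ι a Φ).toLinearPMap

/-- `graphC` is the graph of an operator, namely of `opC`. -/
theorem graph_opC [CompleteSpace H] {τ : ℝ} {ι : V →L[𝕜] H} (hι : Function.Injective ι)
    (hd : DenseRange ι) (a : ℝ → V →ₗ[𝕜] V →ₗ⋆[𝕜] 𝕜) (Φ : H →L[𝕜] H) :
    (opC τ ι a Φ).graph = graphC τ ι a Φ := by
  refine Submodule.toLinearPMap_graph_eq _ ?_
  rintro ⟨u, f⟩ ⟨⟨v, d, g, ⟨e, w⟩, i, q⟩, -⟩ hu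
  change u = 0 at hu
  subst hu
  have hu0 := Lp.coeFn_zero H 2 (volume.restrict (Ioo 0 τ))
  have hv : ∀ᵐ t ∂(volume.restrict (Ioo 0 τ)), v t = 0 := by
    filter_upwards [e, hu0] with t h1 h2
    apply hι
    rw [← h1, map_zero]
    exact h2
  have hd0 : (d : ℝ → (V →L⋆[𝕜] 𝕜)) =ᵐ[volume.restrict (Ioo 0 τ)] 0 := by
    refine HasWeakDeriv.eq_zero (w.congr ?_ (ae_eq_refl _)) (Lp.memLp d)
    filter_upwards [hu0] with t h2
    simp only [h2, Pi.zero_apply, map_zero]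
  have hf : ∀ x : V, ∀ᵐ t ∂(volume.restrict (Ioo 0 τ)), ⟪ι x, f t⟫_𝕜 = 0 := by
    intro x
    filter_upwards [hv, hd0, i x, q] with t h1 h2 h3 h4
    rw [← toAntiDual_apply, ← h4]
    simp [h2, h3, h1]
  obtain ⟨s, hs, hfs⟩ := (Lp.aestronglyMeasurable f).isSeparable_ae_range
  have hf0 : (f : ℝ → H) =ᵐ[volume.restrict (Ioo 0 τ)] 0 := by
    refine ae_eq_zero_of_forall_dual_of_isSeparable 𝕜 hs (fun c => ?_) hfs
    obtain ⟨y, rfl⟩ := (InnerProductSpace.toDual 𝕜 H).surjective c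
    obtain ⟨b, hb, hby⟩ := mem_closure_iff_seq_limit.1 (hd y)
    choose x hx using hb
    have hall : ∀ᵐ t ∂(volume.restrict (Ioo 0 τ)), ∀ n, ⟪ι (x n), f t⟫_𝕜 = 0 :=
      ae_all_iff.2 fun n => hf (x n)
    filter_upwards [hall] with t ht
    have hl : Tendsto (fun n => ⟪b n, f t⟫_𝕜) atTop (𝓝 ⟪y, f t⟫_𝕜) :=
      hby.inner tendsto_const_nhds
    simp only [← hx, ht] at hl
    exact tendsto_nhds_unique hl tendsto_const_nhds
  exact Lp.ext (hf0.trans (Lp.coeFn_zero _ _ _).symm)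

end OperatorC

/-! ### The operator `B = d/dt` -/

section OperatorB

variable {𝕜 : Type*} [RCLike 𝕜] {H : Type*} [NormedAddCommGroup H] [NormedSpace 𝕜 H]

variable (𝕜) in
/-- `f` is the weak derivative of `u` on `(0, τ)`, where the space `H` over `𝕜 = ℝ` or `ℂ` is
considered as a real space by restriction of scalars. -/
def HasWeakDerivK (τ : ℝ) (u f : ℝ → H) : Prop :=
  letI : NormedSpace ℝ H := NormedSpace.restrictScalars ℝ 𝕜 H
  HasWeakDeriv τ u f

/-- The graph of `B`: all pairs `(u, f)` in `L²(0, τ; H) × L²(0, τ; H)` with `u ∈ H¹(0, τ; H)`,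
`u' = f` and `u(0) = Φ u(τ)`. -/
def graphB (τ : ℝ) (Φ : H →L[𝕜] H) : Submodule 𝕜 (L2 τ H × L2 τ H) where
  carrier := {p | HasWeakDerivK 𝕜 τ p.1 p.2 ∧ TimeBoundary τ Φ p.1}
  zero_mem' := by
    let _ : NormedSpace ℝ H := NormedSpace.restrictScalars ℝ 𝕜 H
    have h0 : HasWeakDeriv τ (0 : ℝ → H) 0 := fun φ _ _ _ => by simp
    exact ⟨h0.congr (Lp.coeFn_zero _ _ _).symm (Lp.coeFn_zero _ _ _).symm, TimeBoundary.zero⟩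
  add_mem' := by
    rintro ⟨u₁, f₁⟩ ⟨u₂, f₂⟩ ⟨w₁, b₁⟩ ⟨w₂, b₂⟩
    let _ : NormedSpace ℝ H := NormedSpace.restrictScalars ℝ 𝕜 H
    exact ⟨(HasWeakDeriv.add w₁ w₂ (Lp.memLp u₁) (Lp.memLp u₂) (Lp.memLp f₁) (Lp.memLp f₂)).congr
      (Lp.coeFn_add u₁ u₂).symm (Lp.coeFn_add f₁ f₂).symm, b₁.add b₂⟩
  smul_mem' := by
    rintro c ⟨u, f⟩ ⟨w, b⟩
    let _ : NormedSpace ℝ H := NormedSpace.restrictScalars ℝ 𝕜 H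
    have : IsScalarTower ℝ 𝕜 H := RestrictScalars.isScalarTower ℝ 𝕜 H
    have : SMulCommClass ℝ 𝕜 H := IsScalarTower.to_smulCommClass
    exact ⟨(HasWeakDeriv.smul w c).congr (Lp.coeFn_smul c u).symm (Lp.coeFn_smul c f).symm, b.smul c⟩

/-- The operator `B = d/dt` in `L²(0, τ; H)` with `D(B) = {u ∈ H¹(0, τ; H) : u(0) = Φ u(τ)}`. -/
noncomputable def opB (τ : ℝ) (Φ : H →L[𝕜] H) : L2 τ H →ₗ.[𝕜] L2 τ H :=
  (graphB τ Φ).toLinearPMap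

/-- `graphB` is the graph of an operator, namely of `opB`. -/
theorem graph_opB [CompleteSpace H] (τ : ℝ) (Φ : H →L[𝕜] H) : (opB τ Φ).graph = graphB τ Φ := by
  refine Submodule.toLinearPMap_graph_eq _ ?_
  rintro ⟨u, f⟩ ⟨w, -⟩ hu
  change u = 0 at hu
  subst hu
  let _ : NormedSpace ℝ H := NormedSpace.restrictScalars ℝ 𝕜 H
  have hf0 : (f : ℝ → H) =ᵐ[volume.restrict (Ioo 0 τ)] 0 :=
    HasWeakDeriv.eq_zero (HasWeakDeriv.congr w (Lp.coeFn_zero _ _ _) (ae_eq_refl _)) (Lp.memLp f)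
  exact Lp.ext (hf0.trans (Lp.coeFn_zero _ _ _).symm)

end OperatorB

end TimeBVP

/-! Along `u̇ + 𝒜(·)u = f` one has `d/dt ‖u‖² = 2 Re ⟨u̇, u⟩`, and `‖u(0)‖ = ‖Φ u(τ)‖ ≤ ‖u(τ)‖`, so
`Re ∫ ⟨u̇, u⟩ ≥ 0`; with `Re 𝔞 ≥ 0` this is accretivity. Only real parts matter, so the equation is
solved over `ℝ`, where the Riesz isomorphism turns it into an equation in `L²(0, τ; V)` for the
derivative of `ι* ι v`. Solutions come from Lions' representation theorem, with test functions in
`H¹(0, τ; V)` that need not vanish at the endpoints: the boundary term, weighted by `1 - μ t` for a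
small `μ > 0`, stays coercive, so the value of the solution at `τ` is found together with the
solution itself. Finally, `B` is the operator `C` for `V = H` and the zero form. -/

namespace TimeBVP

/-! ### Primitives of integrable functions -/

section Primitive

variable {E F G : Type*} [NormedAddCommGroup E] [NormedSpace ℝ E]
  [NormedAddCommGroup F] [NormedSpace ℝ F] [NormedAddCommGroup G] [NormedSpace ℝ G]

/-- The primitive of `f` with value `c` at `0`; the absolutely continuous representatives of weakly
differentiable functions on `(0, τ)` are written in this form. -/
noncomputable def prim (c : E) (f : ℝ → E) (t : ℝ) : E := c + ∫ s in (0 : ℝ)..t, f s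

@[simp]
theorem prim_apply_zero (c : E) (f : ℝ → E) : prim c f 0 = c := by simp [prim]

theorem continuousOn_prim {τ : ℝ} (hτ : 0 ≤ τ) (c : E) {f : ℝ → E}
    (hf : IntervalIntegrable f volume 0 τ) : ContinuousOn (prim c f) (Icc 0 τ) := by
  have h := intervalIntegral.continuousOn_primitive_interval' hf left_mem_uIcc
  rw [uIcc_of_le hτ] at h
  exact continuousOn_const.add h

theorem integral_Ioo_eq_intervalIntegral {τ : ℝ} (hτ : 0 ≤ τ) (f : ℝ → E) :
    ∫ t in Ioo 0 τ, f t = ∫ t in (0 : ℝ)..τ, f t := by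
  rw [intervalIntegral.integral_of_le hτ, integral_Ioc_eq_integral_Ioo]

theorem intervalIntegrable_bilin (L : E →L[ℝ] F →L[ℝ] G) {f : ℝ → E} {g : ℝ → F} {a b : ℝ}
    (hab : a ≤ b) (hf : IntervalIntegrable f volume a b) (hg : ContinuousOn g (Icc a b)) :
    IntervalIntegrable (fun r => L (f r) (g r)) volume a b := by
  rw [intervalIntegrable_iff_integrableOn_Ioc_of_le hab] at hf ⊢
  obtain ⟨C, hC⟩ := isCompact_Icc.exists_bound_of_continuousOn hg
  refine (hf.norm.const_mul (‖L‖ * C)).mono' (L.continuous₂.comp_aestronglyMeasurable₂ hf.1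
      ((hg.mono Ioc_subset_Icc_self).aestronglyMeasurable measurableSet_Ioc)) ?_
  filter_upwards [ae_restrict_mem measurableSet_Ioc] with r hr
  calc ‖L (f r) (g r)‖ ≤ ‖L‖ * ‖f r‖ * ‖g r‖ := L.le_opNorm₂ _ _
    _ ≤ ‖L‖ * ‖f r‖ * C := by gcongr; exact hC r (Ioc_subset_Icc_self hr)
    _ = ‖L‖ * C * ‖f r‖ := by ring

/-- Fubini for `f ⊗ g` on `S`, with the second variable integrated first. -/
theorem setIntegral_prod_bilin {α β : Type*} [MeasurableSpace α] [MeasurableSpace β]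
    {μ : Measure α} {ν : Measure β} [SFinite μ] [SFinite ν] [CompleteSpace F] [CompleteSpace G]
    (L : E →L[ℝ] F →L[ℝ] G) {f : α → E} {g : β → F} (hf : Integrable f μ) (hg : Integrable g ν)
    {S : Set (α × β)} (hS : MeasurableSet S) :
    ∫ z in S, L (f z.1) (g z.2) ∂(μ.prod ν) =
      ∫ r, L (f r) (∫ q in Prod.mk r ⁻¹' S, g q ∂ν) ∂μ := by
  have hfg : Integrable (fun z : α × β => L (f z.1) (g z.2)) (μ.prod ν) :=
    hf.op_fst_snd (op := fun x y => L x y) (by fun_prop) ⟨‖L‖, L.le_opNorm₂⟩ hg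
  rw [← integral_indicator hS, integral_prod _ (hfg.indicator hS)]
  congr with r
  rw [← (L (f r)).integral_comp_comm hg.integrableOn,
    ← integral_indicator (measurable_prodMk_left hS)]
  rfl

theorem bilin_intervalIntegral [CompleteSpace E] [CompleteSpace F] [CompleteSpace G]
    (L : E →L[ℝ] F →L[ℝ] G) {f : ℝ → E} {g : ℝ → F} {a b : ℝ} (hab : a ≤ b)
    (hf : IntervalIntegrable f volume a b) (hg : IntervalIntegrable g volume a b) :
    L (∫ r in a..b, f r) (∫ r in a..b, g r) =
      (∫ r in a..b, L (f r) (∫ q in a..r, g q)) + ∫ r in a..b, L (∫ q in a..r, f q) (g r) := by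
  rw [intervalIntegrable_iff_integrableOn_Ioc_of_le hab] at hf hg
  set S := {z : ℝ × ℝ | z.2 ≤ z.1}
  have hS : MeasurableSet S := measurableSet_le measurable_snd measurable_fst
  have hfg : Integrable (fun z : ℝ × ℝ => L (f z.1) (g z.2))
      ((volume.restrict (Ioc a b)).prod (volume.restrict (Ioc a b))) :=
    hf.op_fst_snd (op := fun x y => L x y) (by fun_prop) ⟨‖L‖, L.le_opNorm₂⟩ hg
  simp only [intervalIntegral.integral_of_le hab]
  rw [← integral_prod_bilin L hf hg, ← integral_add_compl hS hfg]
  congr 1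
  · rw [setIntegral_prod_bilin L hf hg hS]
    refine setIntegral_congr_fun measurableSet_Ioc fun r hr => ?_
    change L (f r) (∫ q in Iic r, g q ∂_) = _
    rw [Measure.restrict_restrict measurableSet_Iic, inter_comm, Ioc_inter_Iic, min_eq_right hr.2,
      intervalIntegral.integral_of_le hr.1.le]
  · rw [← (Measure.measurePreserving_swap).setIntegral_preimage_emb
      MeasurableEquiv.prodComm.measurableEmbedding]
    refine (setIntegral_prod_bilin L.flip hg hf (measurable_swap hS.compl)).trans
      (setIntegral_congr_fun measurableSet_Ioc fun r hr => ?_)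
    have h : Prod.mk r ⁻¹' (Prod.swap ⁻¹' Sᶜ) = Iio r := by ext; simp [S]
    change L (∫ q in _, f q ∂_) (g r) = _
    have h' : Iio r ∩ Ioc a b = Ioo a r := by
      ext q
      simp only [mem_inter_iff, mem_Iio, mem_Ioc, mem_Ioo]
      grind
    rw [h, Measure.restrict_restrict measurableSet_Iio, h',
      intervalIntegral.integral_of_le hr.1.le, integral_Ioc_eq_integral_Ioo]

theorem bilin_prim [CompleteSpace E] [CompleteSpace F] [CompleteSpace G]
    (L : E →L[ℝ] F →L[ℝ] G) {f : ℝ → E} {g : ℝ → F} {τ : ℝ}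
    (hf : IntervalIntegrable f volume 0 τ) (hg : IntervalIntegrable g volume 0 τ)
    (c : E) (d : F) {t : ℝ} (ht : t ∈ Icc 0 τ) :
    L (prim c f t) (prim d g t) =
      prim (L c d) (fun r => L (f r) (prim d g r) + L (prim c f r) (g r)) t := by
  have hsub : uIcc 0 t ⊆ uIcc 0 τ := by
    rw [uIcc_of_le ht.1, uIcc_of_le (ht.1.trans ht.2)]
    exact Icc_subset_Icc_right ht.2
  replace hf := hf.mono_set hsub
  replace hg := hg.mono_set hsub
  have hL := intervalIntegrable_bilin L ht.1 hf (continuousOn_prim ht.1 0 hg)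
  have hR := intervalIntegrable_bilin L.flip ht.1 hg (continuousOn_prim ht.1 0 hf)
  have hLc := intervalIntegrable_bilin L ht.1 hf (continuousOn_const (c := d))
  have hRc := intervalIntegrable_bilin L.flip ht.1 hg (continuousOn_const (c := c))
  have hLd : ∫ r in (0 : ℝ)..t, L (f r) d = L (∫ r in (0 : ℝ)..t, f r) d :=
    (L.flip d).intervalIntegral_comp_comm hf
  have hcR : ∫ r in (0 : ℝ)..t, L c (g r) = L c (∫ r in (0 : ℝ)..t, g r) :=
    (L c).intervalIntegral_comp_comm hg
  simp only [prim, zero_add, ContinuousLinearMap.flip_apply, map_add, _root_.add_apply]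
    at hL hR hLc hRc ⊢
  rw [intervalIntegral.integral_add (hLc.add hL) (hRc.add hR),
    intervalIntegral.integral_add hLc hL, intervalIntegral.integral_add hRc hR, hLd, hcR,
    bilin_intervalIntegral L ht.1 hf hg]
  abel

end Primitive

/-! ### Weak derivatives and primitives -/

section WeakDerivPrim

variable {X : Type*} [NormedAddCommGroup X] [NormedSpace ℝ X] {τ : ℝ}

theorem exists_Icc_superset_of_isCompact {K : Set ℝ} {a b : ℝ} (hK : IsCompact K)
    (hab : K ⊆ Ioo a b) : ∃ p q, a < p ∧ q < b ∧ K ⊆ Icc p q := by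
  rcases K.eq_empty_or_nonempty with rfl | hne
  · exact ⟨a + 1, b - 1, by simp, by simp, empty_subset _⟩
  · exact ⟨sInf K, sSup K, (hab (hK.sInf_mem hne)).1, (hab (hK.sSup_mem hne)).2,
      fun x hx => ⟨csInf_le hK.bddBelow hx, le_csSup hK.bddAbove hx⟩⟩

theorem intervalIntegral_eq_zero_of_forall {f : ℝ → X} {a b : ℝ} (h : ∀ t ∈ uIoc a b, f t = 0) :
    ∫ t in a..b, f t = 0 :=
  intervalIntegral.integral_zero_ae (ae_of_all _ h)

theorem exists_contDiff_deriv_eq {χ : ℝ → ℝ} {a b : ℝ} (hχ : ContDiff ℝ ∞ χ)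
    (hc : HasCompactSupport χ) (hs : tsupport χ ⊆ Ioo a b) (h0 : ∫ t in a..b, χ t = 0) :
    ∃ φ : ℝ → ℝ, ContDiff ℝ ∞ φ ∧ HasCompactSupport φ ∧ tsupport φ ⊆ Ioo a b ∧ deriv φ = χ := by
  set φ : ℝ → ℝ := fun t => ∫ s in a..t, χ s
  have hint (s t : ℝ) : IntervalIntegrable χ volume s t := hχ.continuous.intervalIntegrable s t
  have hder (t : ℝ) : HasDerivAt φ (χ t) t :=
    intervalIntegral.integral_hasDerivAt_right (hint a t)
      (hχ.continuous.stronglyMeasurableAtFilter _ _) hχ.continuous.continuousAt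
  have hφ' : deriv φ = χ := funext fun t => (hder t).deriv
  obtain ⟨p, q, hp, hq, hpq⟩ := exists_Icc_superset_of_isCompact hc hs
  have hχ0 (t : ℝ) (ht : t ∉ Icc p q) : χ t = 0 :=
    image_eq_zero_of_notMem_tsupport fun h => ht (hpq h)
  have hsupp : tsupport φ ⊆ Icc p q := by
    refine closure_minimal (fun t ht => ?_) isClosed_Icc
    by_contra hn
    rcases not_and_or.1 hn with h | h
    · refine ht (intervalIntegral_eq_zero_of_forall fun s hs => hχ0 s fun hspq => ?_)
      rcases mem_uIoc.1 hs with hs | hs <;> linarith [hspq.1, hs.1, hs.2]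
    · refine ht ?_
      change ∫ s in a..t, χ s = 0
      rw [← intervalIntegral.integral_add_adjacent_intervals (hint a b) (hint b t), h0, zero_add]
      refine intervalIntegral_eq_zero_of_forall fun s hs => hχ0 s fun hspq => ?_
      rcases mem_uIoc.1 hs with hs | hs <;> linarith [hspq.2, hs.1, hs.2]
  refine ⟨φ, ?_, isCompact_Icc.of_isClosed_subset (isClosed_tsupport _) hsupp,
    hsupp.trans (Icc_subset_Ioo hp hq), hφ'⟩
  exact contDiff_infty_iff_deriv.2 ⟨fun t => (hder t).differentiableAt, by rwa [hφ']⟩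

theorem exists_contDiff_integral_eq_one {a b : ℝ} (hab : a < b) :
    ∃ η : ℝ → ℝ, ContDiff ℝ ∞ η ∧ HasCompactSupport η ∧ tsupport η ⊆ Ioo a b ∧
      ∫ t, η t = 1 := by
  let β : ContDiffBump ((a + b) / 2) :=
    ⟨(b - a) / 8, (b - a) / 4, by linarith, by linarith⟩
  refine ⟨β.normed volume, β.contDiff_normed, β.hasCompactSupport_normed, ?_, β.integral_normed⟩
  rw [β.tsupport_normed_eq, Real.closedBall_eq_Icc]
  refine Icc_subset_Ioo ?_ ?_
  · change a < (a + b) / 2 - (b - a) / 4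
    linarith
  · change (a + b) / 2 + (b - a) / 4 < b
    linarith

theorem setIntegral_smul_eq_integral_of_tsupport_subset {φ : ℝ → ℝ} {s : Set ℝ}
    (hs : tsupport φ ⊆ s) (f : ℝ → X) : ∫ t in s, φ t • f t = ∫ t, φ t • f t :=
  setIntegral_eq_integral_of_forall_compl_eq_zero fun t ht => by
    rw [image_eq_zero_of_notMem_tsupport fun h => ht (hs h), zero_smul]

theorem integrable_smul_of_hasCompactSupport {μ : Measure ℝ} {f : ℝ → X} (hf : Integrable f μ)
    {φ : ℝ → ℝ} (hφ : Continuous φ) (hc : HasCompactSupport φ) :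
    Integrable (fun t => φ t • f t) μ := by
  obtain ⟨C, hC⟩ := hc.exists_bound_of_continuous hφ
  exact hf.bdd_smul C hφ.aestronglyMeasurable (ae_of_all _ hC)

theorem exists_contDiff_deriv_eq_sub {ψ η : ℝ → ℝ} {a b : ℝ} (hab : a ≤ b)
    (ψd : ContDiff ℝ ∞ ψ) (ψc : HasCompactSupport ψ) (ψs : tsupport ψ ⊆ Ioo a b)
    (ηd : ContDiff ℝ ∞ η) (ηc : HasCompactSupport η) (ηs : tsupport η ⊆ Ioo a b)
    (ηi : ∫ t, η t = 1) :
    ∃ φ : ℝ → ℝ, ContDiff ℝ ∞ φ ∧ HasCompactSupport φ ∧ tsupport φ ⊆ Ioo a b ∧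
      deriv φ = fun t => ψ t - (∫ s, ψ s) * η t := by
  set m := ∫ s, ψ s
  have hs : tsupport (fun t => ψ t - m * η t) ⊆ Ioo a b := (tsupport_sub _ _).trans <|
    union_subset ψs ((closure_mono (Function.support_const_smul_subset m η)).trans ηs)
  refine exists_contDiff_deriv_eq (ψd.sub (contDiff_const.mul ηd))
    (ψc.sub (ηc.mul_left (f := fun _ => m))) hs ?_
  have h := setIntegral_smul_eq_integral_of_tsupport_subset hs (fun _ => (1 : ℝ))
  simp only [smul_eq_mul, mul_one] at h
  rw [intervalIntegral.integral_of_le hab, integral_Ioc_eq_integral_Ioo, h,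
    integral_sub (ψd.continuous.integrable_of_hasCompactSupport ψc)
      ((ηd.continuous.integrable_of_hasCompactSupport ηc).const_mul m),
    integral_const_mul, ηi, mul_one, sub_self]

variable [CompleteSpace X]

/-- The lemma of du Bois-Reymond. -/
theorem HasWeakDeriv.ae_eq_const (hτ : 0 < τ) {g : ℝ → X}
    (hg : Integrable g (volume.restrict (Ioo 0 τ))) (h : HasWeakDeriv τ g 0) :
    ∃ c : X, g =ᵐ[volume.restrict (Ioo 0 τ)] fun _ => c := by
  obtain ⟨η, ηd, ηc, ηs, ηi⟩ := exists_contDiff_integral_eq_one hτ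
  set c := ∫ t in Ioo 0 τ, η t • g t with hc
  have hgc : Integrable (fun t => g t - c) (volume.restrict (Ioo 0 τ)) :=
    hg.sub (integrable_const c)
  suffices key : ∀ ψ : ℝ → ℝ, ContDiff ℝ ∞ ψ → HasCompactSupport ψ → tsupport ψ ⊆ Ioo 0 τ →
      ∫ t, ψ t • (g t - c) = 0 by
    have h0 := isOpen_Ioo.ae_eq_zero_of_integral_contDiff_smul_eq_zero (μ := volume)
      (IntegrableOn.locallyIntegrableOn hgc) key
    refine ⟨c, ?_⟩
    filter_upwards [(ae_restrict_iff' measurableSet_Ioo).2 h0] with t ht using sub_eq_zero.1 ht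
  intro ψ ψd ψc ψs
  obtain ⟨φ, φd, φc, φs, φ'⟩ := exists_contDiff_deriv_eq_sub hτ.le ψd ψc ψs ηd ηc ηs ηi
  have iψg := integrable_smul_of_hasCompactSupport hg ψd.continuous ψc
  have iηg := integrable_smul_of_hasCompactSupport hg ηd.continuous ηc
  have iψ : Integrable ψ := ψd.continuous.integrable_of_hasCompactSupport ψc
  have hφ := h φ φd φc φs
  simp only [φ', Pi.zero_apply, smul_zero, integral_zero, neg_zero, sub_smul, mul_smul] at hφ
  rw [integral_sub iψg (g := fun t => (∫ s, ψ s) • η t • g t) (iηg.smul _), integral_smul, ← hc,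
    sub_eq_zero] at hφ
  rw [← setIntegral_smul_eq_integral_of_tsupport_subset ψs]
  simp only [smul_sub]
  rw [integral_sub iψg (iψ.restrict.smul_const c), hφ,
    setIntegral_smul_eq_integral_of_tsupport_subset ψs, integral_smul_const, sub_self]

theorem hasWeakDeriv_prim (hτ : 0 ≤ τ) (c : X) {f : ℝ → X} (hf : IntervalIntegrable f volume 0 τ) :
    HasWeakDeriv τ (prim c f) f := by
  intro φ φd φc φs
  have cd : Continuous (deriv φ) := φd.continuous_deriv (by simp)
  have h0 : φ 0 = 0 := image_eq_zero_of_notMem_tsupport fun h => lt_irrefl _ (φs h).1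
  have h1 : φ τ = 0 := image_eq_zero_of_notMem_tsupport fun h => lt_irrefl _ (φs h).2
  have hφ (t : ℝ) : prim 0 (deriv φ) t = φ t := by
    rw [prim, intervalIntegral.integral_deriv_eq_sub
      (fun s _ => (φd.differentiable (by simp)).differentiableAt) (cd.intervalIntegrable _ _), h0]
    simp
  have hip : Integrable (prim c f) (volume.restrict (Ioo 0 τ)) :=
    (continuousOn_prim hτ c hf).integrableOn_Icc.mono_set Ioo_subset_Icc_self
  have hif : Integrable f (volume.restrict (Ioo 0 τ)) :=
    (intervalIntegrable_iff_integrableOn_Ioo_of_le hτ).1 hf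
  have hprod := bilin_prim (ContinuousLinearMap.lsmul ℝ ℝ : ℝ →L[ℝ] X →L[ℝ] X)
    (cd.intervalIntegrable 0 τ) hf 0 c (right_mem_Icc.2 hτ)
  simp only [hφ, ContinuousLinearMap.lsmul_apply, h1, zero_smul, prim.eq_1 (0 : X), zero_add]
    at hprod
  rw [← integral_Ioo_eq_intervalIntegral hτ, integral_add
    (integrable_smul_of_hasCompactSupport hip cd φc.deriv)
    (integrable_smul_of_hasCompactSupport hif φd.continuous φc)] at hprod
  exact eq_neg_of_add_eq_zero_left hprod.symm

theorem HasWeakDeriv.ae_eq_prim (hτ : 0 < τ) {u u' : ℝ → X} (h : HasWeakDeriv τ u u')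
    (hu : Integrable u (volume.restrict (Ioo 0 τ)))
    (hu' : Integrable u' (volume.restrict (Ioo 0 τ))) :
    ∃ c : X, u =ᵐ[volume.restrict (Ioo 0 τ)] prim c u' := by
  have hi : IntervalIntegrable u' volume 0 τ :=
    (intervalIntegrable_iff_integrableOn_Ioo_of_le hτ.le).2 hu'
  have hp : Integrable (prim 0 u') (volume.restrict (Ioo 0 τ)) :=
    (continuousOn_prim hτ.le 0 hi).integrableOn_Icc.mono_set Ioo_subset_Icc_self
  have hw : HasWeakDeriv τ (fun t => u t - prim 0 u' t) 0 := by
    intro φ φd φc φs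
    have cd : Continuous (deriv φ) := φd.continuous_deriv (by simp)
    simp only [smul_sub, Pi.zero_apply, smul_zero, integral_zero, neg_zero]
    rw [integral_sub (integrable_smul_of_hasCompactSupport hu cd φc.deriv)
      (integrable_smul_of_hasCompactSupport hp cd φc.deriv), h φ φd φc φs,
      hasWeakDeriv_prim hτ.le 0 hi φ φd φc φs, sub_self]
  obtain ⟨c, hc⟩ := hw.ae_eq_const hτ (hu.sub hp)
  refine ⟨c, ?_⟩
  filter_upwards [hc] with t ht
  rw [← sub_add_cancel (u t) (prim 0 u' t), ← Pi.sub_apply, ht, prim, prim, zero_add]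

end WeakDerivPrim

/-! ### Regularized inverses of a positive operator -/

section Resolvent

variable {𝕜 : Type*} [RCLike 𝕜] {V : Type*} [NormedAddCommGroup V] [InnerProductSpace 𝕜 V]
  [CompleteSpace V] {T : V →L[𝕜] V} {ε : ℝ}

omit [CompleteSpace V] in
theorem norm_sq_add_norm_smul_sq_le (hT : T.IsPositive) (hε : 0 ≤ ε) (x : V) :
    ‖T x‖ ^ 2 + ‖(ε : 𝕜) • x‖ ^ 2 ≤ ‖T x + (ε : 𝕜) • x‖ ^ 2 := by
  have h := mul_nonneg hε (hT.re_inner_nonneg_left x)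
  rw [norm_add_sq (𝕜 := 𝕜), inner_smul_right, RCLike.re_ofReal_mul]
  linarith

theorem isUnit_algebraMap_add (hT : T.IsPositive) (hε : 0 < ε) :
    IsUnit (algebraMap 𝕜 (V →L[𝕜] V) ε - -T) := by
  refine ContinuousLinearMap.isUnit_of_forall_le_norm_inner_map _ (c := ⟨ε, hε.le⟩) hε fun x => ?_
  have h : RCLike.re ⟪(algebraMap 𝕜 (V →L[𝕜] V) ε - -T) x, x⟫_𝕜 =
      ε * ‖x‖ ^ 2 + RCLike.re ⟪T x, x⟫_𝕜 := by
    have hx : (algebraMap 𝕜 (V →L[𝕜] V) ε - -T) x = (ε : 𝕜) • x + T x := by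
      simp [Algebra.algebraMap_eq_smul_one]
    rw [hx, inner_add_left, inner_smul_left, RCLike.conj_ofReal, map_add, RCLike.re_ofReal_mul,
      inner_self_eq_norm_sq]
  calc ‖x‖ ^ 2 * ε ≤ RCLike.re ⟪(algebraMap 𝕜 (V →L[𝕜] V) ε - -T) x, x⟫_𝕜 := by
        linarith [hT.re_inner_nonneg_left x]
    _ ≤ _ := RCLike.re_le_norm _

theorem apply_resolvent_neg_add (hT : T.IsPositive) (hε : 0 < ε) (x : V) :
    T (resolvent (-T) (ε : 𝕜) x) + (ε : 𝕜) • resolvent (-T) (ε : 𝕜) x = x := by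
  have h := DFunLike.congr_fun (Ring.mul_inverse_cancel _ (isUnit_algebraMap_add hT hε)) x
  simpa [resolvent, Algebra.algebraMap_eq_smul_one, add_comm] using h

theorem resolvent_neg_apply_add (hT : T.IsPositive) (hε : 0 < ε) (x : V) :
    resolvent (-T) (ε : 𝕜) (T x) + (ε : 𝕜) • resolvent (-T) (ε : 𝕜) x = x := by
  have h := DFunLike.congr_fun (Ring.inverse_mul_cancel _ (isUnit_algebraMap_add hT hε)) x
  simpa [resolvent, Algebra.algebraMap_eq_smul_one, add_comm] using h

theorem isSelfAdjoint_resolvent_neg (hT : T.IsPositive) (ε : ℝ) :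
    IsSelfAdjoint (resolvent (-T) (ε : 𝕜)) := by
  have h : IsSelfAdjoint (algebraMap 𝕜 (V →L[𝕜] V) ε - -T) :=
    (IsSelfAdjoint.algebraMap _ (RCLike.conj_ofReal ε)).sub hT.isSelfAdjoint.neg
  rw [IsSelfAdjoint, resolvent, ← Ring.inverse_star, h.star_eq]

theorem norm_resolvent_neg_apply_le (hT : T.IsPositive) (hε : 0 < ε) (x : V) :
    ‖resolvent (-T) (ε : 𝕜) (T x)‖ ≤ ‖x‖ := by
  have hcomm := (resolvent_neg_apply_add hT hε x).trans (apply_resolvent_neg_add hT hε x).symm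
  have h := norm_sq_add_norm_smul_sq_le hT hε.le (resolvent (-T) (ε : 𝕜) x)
  rw [apply_resolvent_neg_add hT hε] at h
  rw [add_right_cancel hcomm]
  exact (sq_le_sq₀ (norm_nonneg _) (norm_nonneg _)).1
    ((le_add_of_nonneg_right (sq_nonneg _)).trans h)

theorem norm_smul_resolvent_neg_le (hT : T.IsPositive) (hε : 0 < ε) (x : V) :
    ‖(ε : 𝕜) • resolvent (-T) (ε : 𝕜) x‖ ≤ ‖x‖ := by
  have h := norm_sq_add_norm_smul_sq_le hT hε.le (resolvent (-T) (ε : 𝕜) x)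
  rw [apply_resolvent_neg_add hT hε] at h
  exact (sq_le_sq₀ (norm_nonneg _) (norm_nonneg _)).1
    ((le_add_of_nonneg_left (sq_nonneg _)).trans h)

theorem tendsto_smul_resolvent_neg {ε : ℕ → ℝ} (hT : T.IsPositive) (hd : DenseRange T)
    (hε : ∀ n, 0 < ε n) (hε0 : Tendsto ε atTop (𝓝 0)) (x : V) :
    Tendsto (fun n => (ε n : 𝕜) • resolvent (-T) (ε n : 𝕜) x) atTop (𝓝 0) := by
  have hlip (n : ℕ) : LipschitzWith 1 (fun x => (ε n : 𝕜) • resolvent (-T) (ε n : 𝕜) x) :=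
    LipschitzWith.of_dist_le_mul fun x y => by
      rw [NNReal.coe_one, one_mul, dist_eq_norm, dist_eq_norm, ← smul_sub, ← map_sub]
      exact norm_smul_resolvent_neg_le hT (hε n) _
  have hclosed :=
    (LipschitzWith.uniformEquicontinuous _ 1 hlip).equicontinuous.isClosed_setOfPred_tendsto
      (l := atTop) (continuous_const (y := (0 : V)))
  refine hclosed.closure_subset_iff.2 ?_ (hd x)
  rintro _ ⟨y, rfl⟩
  refine squeeze_zero_norm (a := fun n => ε n * ‖y‖) (fun n => ?_)
    (by simpa using hε0.mul_const ‖y‖)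
  rw [norm_smul, RCLike.norm_of_nonneg (hε n).le]
  gcongr
  exacts [(hε n).le, norm_resolvent_neg_apply_le hT (hε n) y]

end Resolvent

section ApproxInverse

variable {V : Type*} [NormedAddCommGroup V] [InnerProductSpace ℝ V] [CompleteSpace V]

/-- Bounded self-adjoint operators `S n` which approximate the (in general unbounded) inverse of an
injective positive operator `T`: the `S n T` are contractions and converge strongly to the
identity. -/
structure IsApproxInverse (T : V →L[ℝ] V) (S : ℕ → V →L[ℝ] V) : Prop where
  isSelfAdjoint : ∀ n, IsSelfAdjoint (S n)
  norm_apply_le : ∀ n x, ‖S n (T x)‖ ≤ ‖x‖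
  tendsto : ∀ x, Tendsto (fun n => S n (T x)) atTop (𝓝 x)

theorem exists_isApproxInverse {T : V →L[ℝ] V} (hT : T.IsPositive) (hinj : Function.Injective T) :
    ∃ S, IsApproxInverse T S := by
  have hd : DenseRange T := by
    have h : (T : V →ₗ[ℝ] V).rangeᗮ = ⊥ := by
      rw [T.orthogonal_range, hT.isSelfAdjoint.adjoint_eq]
      exact LinearMap.ker_eq_bot.2 hinj
    exact Submodule.dense_iff_topologicalClosure_eq_top.2
      (Submodule.topologicalClosure_eq_top_iff.2 h)
  have hε (n : ℕ) : (0 : ℝ) < 1 / (n + 1) := Nat.one_div_pos_of_nat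
  refine ⟨fun n => resolvent (-T) (1 / (n + 1) : ℝ), fun n => isSelfAdjoint_resolvent_neg hT _,
    fun n => norm_resolvent_neg_apply_le hT (hε n), fun x => ?_⟩
  have h0 : Tendsto (fun n : ℕ => 1 / ((n : ℝ) + 1)) atTop (𝓝 0) :=
    tendsto_one_div_add_atTop_nhds_zero_nat
  have h := (tendsto_smul_resolvent_neg hT hd hε h0 x).const_sub x
  rw [sub_zero] at h
  exact h.congr fun n => sub_eq_of_eq_add (resolvent_neg_apply_add hT (hε n) x).symm

end ApproxInverse

/-! ### The energy identity -/

section Energy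

theorem tendsto_integral_bilin {Ω E F G : Type*} [MeasurableSpace Ω] {μ : Measure Ω}
    [NormedAddCommGroup E] [NormedSpace ℝ E] [NormedAddCommGroup F] [NormedSpace ℝ F]
    [NormedAddCommGroup G] [NormedSpace ℝ G] (L : E →L[ℝ] F →L[ℝ] G) {f : Ω → E} {g : Ω → ℝ}
    {u : ℕ → Ω → F} {u₀ : Ω → F} (hf : MemLp f 2 μ) (hg : MemLp g 2 μ)
    (hu : ∀ n, AEStronglyMeasurable (u n) μ) (hb : ∀ n t, ‖u n t‖ ≤ g t)
    (h : ∀ t, Tendsto (fun n => u n t) atTop (𝓝 (u₀ t))) :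
    Tendsto (fun n => ∫ t, L (f t) (u n t) ∂μ) atTop (𝓝 (∫ t, L (f t) (u₀ t) ∂μ)) := by
  refine tendsto_integral_of_dominated_convergence (fun t => ‖L‖ * (‖f t‖ * g t))
    (fun n => L.continuous₂.comp_aestronglyMeasurable₂ hf.1 (hu n))
    ((hf.norm.integrable_mul hg).const_mul _) (fun n => ae_of_all _ fun t => ?_)
    (ae_of_all _ fun t => ((L (f t)).continuous.tendsto _).comp (h t))
  calc ‖L (f t) (u n t)‖ ≤ ‖L‖ * ‖f t‖ * ‖u n t‖ := L.le_opNorm₂ _ _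
    _ ≤ ‖L‖ * ‖f t‖ * g t := by gcongr; exact hb n t
    _ = ‖L‖ * (‖f t‖ * g t) := mul_assoc _ _ _

theorem uniformCauchySeqOn_of_norm_sub_sq_le {α E : Type*} [SeminormedAddCommGroup E]
    {w : ℕ → α → E} {s : Set α} {a : α} {δ : ℕ → ℝ} (ha : CauchySeq fun n => w n a)
    (hδ : Tendsto δ atTop (𝓝 0))
    (h : ∀ n m, ∀ t ∈ s, ‖w n t - w m t‖ ^ 2 ≤ ‖w n a - w m a‖ ^ 2 + (δ n + δ m)) :
    UniformCauchySeqOn w atTop s := by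
  rw [Metric.uniformCauchySeqOn_iff]
  intro ε hε
  obtain ⟨N₁, hN₁⟩ := Metric.cauchySeq_iff.1 ha (ε / 2) (half_pos hε)
  obtain ⟨N₂, hN₂⟩ := (hδ.eventually (gt_mem_nhds (show 0 < ε ^ 2 / 4 by positivity))
    ).exists_forall_of_atTop
  refine ⟨max N₁ N₂, fun m hm n hn t ht => ?_⟩
  have ha' := hN₁ m (le_of_max_le_left hm) n (le_of_max_le_left hn)
  have hδm := hN₂ m (le_of_max_le_right hm)
  have hδn := hN₂ n (le_of_max_le_right hn)
  rw [dist_eq_norm] at ha' ⊢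
  refine lt_of_pow_lt_pow_left₀ 2 hε.le ?_
  nlinarith [h m n t ht, norm_nonneg (w m a - w n a)]

variable {V H : Type*} [NormedAddCommGroup V] [InnerProductSpace ℝ V] [CompleteSpace V]
  [NormedAddCommGroup H] [InnerProductSpace ℝ H] [CompleteSpace H] {τ : ℝ} {D v : ℝ → V}

theorem norm_sq_map_prim (K : V →L[ℝ] H) (hD : IntervalIntegrable D volume 0 τ) (c : V) {t : ℝ}
    (ht : t ∈ Icc 0 τ) :
    ‖K (prim c D t)‖ ^ 2 =
      ‖K c‖ ^ 2 + ∫ r in (0 : ℝ)..t, 2 * ⟪D r, K.adjoint (K (prim c D r))⟫_ℝ := by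
  have h := bilin_prim ((innerSL ℝ).bilinearComp K K) hD hD c c ht
  simp only [ContinuousLinearMap.bilinearComp_apply, innerSL_apply_apply,
    real_inner_self_eq_norm_sq] at h
  rw [h, prim]
  congr 2
  ext r
  rw [ContinuousLinearMap.adjoint_inner_right, real_inner_comm (K (D r)), two_mul]

theorem norm_sq_map_prim_le (hτ : 0 ≤ τ) (K : V →L[ℝ] H) (hD : IntervalIntegrable D volume 0 τ)
    (c : V) {t s : ℝ} (ht : t ∈ Icc 0 τ) (hs : s ∈ Icc 0 τ) :
    ‖K (prim c D t)‖ ^ 2 ≤ ‖K (prim c D s)‖ ^ 2 +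
      ∫ r in Ioo 0 τ, 2 * (‖D r‖ * ‖K.adjoint (K (prim c D r))‖) := by
  set k : ℝ → ℝ := fun r => 2 * ⟪D r, K.adjoint (K (prim c D r))⟫_ℝ
  have hKW : ContinuousOn (fun r => K.adjoint (K (prim c D r))) (Icc 0 τ) :=
    (K.adjoint.comp K).continuous.comp_continuousOn (continuousOn_prim hτ c hD)
  have hk : IntervalIntegrable k volume 0 τ :=
    (intervalIntegrable_bilin (innerSL ℝ) hτ hD hKW).const_mul 2
  have hkn : IntervalIntegrable (fun r => 2 * (‖D r‖ * ‖K.adjoint (K (prim c D r))‖)) volume 0 τ :=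
    (intervalIntegrable_bilin (ContinuousLinearMap.mul ℝ ℝ) hτ hD.norm hKW.norm).const_mul 2
  have hsub {r : ℝ} (hr : r ∈ Icc 0 τ) : IntervalIntegrable k volume 0 r :=
    hk.mono_set (uIcc_subset_uIcc_left (by rwa [uIcc_of_le hτ]))
  rw [norm_sq_map_prim K hD c ht, norm_sq_map_prim K hD c hs, add_assoc, add_le_add_iff_left,
    ← sub_le_iff_le_add', intervalIntegral.integral_interval_sub_left (hsub ht) (hsub hs),
    integral_Ioo_eq_intervalIntegral hτ, intervalIntegral.integral_of_le hτ]
  calc ∫ r in s..t, k r ≤ ‖∫ r in s..t, k r‖ := Real.le_norm_self _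
    _ ≤ ∫ r in uIoc s t, ‖k r‖ := intervalIntegral.norm_integral_le_integral_norm_uIoc
    _ ≤ ∫ r in Ioc 0 τ, ‖k r‖ := setIntegral_mono_set hk.1.norm (ae_of_all _ fun _ => norm_nonneg _)
        (Ioc_subset_Ioc (le_min hs.1 ht.1) (max_le hs.2 ht.2)).eventuallyLE
    _ ≤ ∫ r in Ioc 0 τ, 2 * (‖D r‖ * ‖K.adjoint (K (prim c D r))‖) := by
        refine integral_mono hk.1.norm hkn.1 fun r => ?_
        simp only [k, norm_mul, Real.norm_ofNat]
        gcongr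
        exact norm_inner_le_norm _ _

theorem IsApproxInverse.tendsto_comp {T : V →L[ℝ] V} {S : ℕ → V →L[ℝ] V}
    (hS : IsApproxInverse T S) (x : V) :
    Tendsto (fun n => S n (T (S n (T x)))) atTop (𝓝 x) := by
  have h0 : Tendsto (fun n => S n (T (S n (T x) - x))) atTop (𝓝 0) :=
    squeeze_zero_norm (fun n => hS.norm_apply_le n _)
      (by simpa using ((hS.tendsto x).sub_const x).norm)
  simpa using h0.add (hS.tendsto x)

section Regularization

variable {ι : V →L[ℝ] H} {S : ℕ → V →L[ℝ] V} {c : V}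

theorem adjoint_comp_apply {A : V →L[ℝ] V} (hA : IsSelfAdjoint A) (x : V) :
    (ι.comp A).adjoint (ι.comp A x) = A (ι.adjoint.comp ι (A x)) := by
  rw [ContinuousLinearMap.adjoint_comp, hA.adjoint_eq]
  rfl

theorem IsApproxInverse.tendsto_integral_norm_sub {T : V →L[ℝ] V} (hS : IsApproxInverse T S)
    {μ : Measure ℝ} (hv : MemLp v 2 μ) (hD : MemLp D 2 μ) :
    Tendsto (fun n => ∫ t, ‖D t‖ * ‖S n (T (v t)) - v t‖ ∂μ) atTop (𝓝 0) := by
  have h := tendsto_integral_bilin (ContinuousLinearMap.mul ℝ ℝ) (u₀ := 0)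
    (u := fun n t => ‖S n (T (v t)) - v t‖) hD.norm (hv.norm.const_mul 2)
    (fun n => ((((S n).comp T).continuous.comp_aestronglyMeasurable hv.1).sub hv.1).norm)
    (fun n t => ?_) (fun t => ?_)
  · simpa using h
  · rw [norm_norm]
    linarith [norm_sub_le (S n (T (v t))) (v t), hS.norm_apply_le n (v t)]
  · simpa using ((hS.tendsto (v t)).sub_const (v t)).norm

theorem IsApproxInverse.norm_sub_sq_le (hτ : 0 ≤ τ) (hS : IsApproxInverse (ι.adjoint.comp ι) S)
    (hv : MemLp v 2 (volume.restrict (Ioo 0 τ))) (hD : MemLp D 2 (volume.restrict (Ioo 0 τ)))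
    (hW : ∀ᵐ t ∂(volume.restrict (Ioo 0 τ)), prim c D t = ι.adjoint.comp ι (v t)) (n m : ℕ)
    {t s : ℝ} (ht : t ∈ Icc 0 τ) (hs : s ∈ Icc 0 τ) :
    ‖ι.comp (S n - S m) (prim c D t)‖ ^ 2 ≤ ‖ι.comp (S n - S m) (prim c D s)‖ ^ 2 +
      ((4 * ∫ r in Ioo 0 τ, ‖D r‖ * ‖S n (ι.adjoint.comp ι (v r)) - v r‖) +
        4 * ∫ r in Ioo 0 τ, ‖D r‖ * ‖S m (ι.adjoint.comp ι (v r)) - v r‖) := by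
  set T := ι.adjoint.comp ι
  have hA := (hS.isSelfAdjoint n).sub (hS.isSelfAdjoint m)
  have hi (k : ℕ) : Integrable (fun r => ‖D r‖ * ‖S k (T (v r)) - v r‖)
      (volume.restrict (Ioo 0 τ)) :=
    hD.norm.integrable_mul ((((S k).comp T).comp_memLp' hv).sub hv).norm
  have hDI : IntervalIntegrable D volume 0 τ :=
    (intervalIntegrable_iff_integrableOn_Ioo_of_le hτ).2 (hD.integrable one_le_two)
  have hbound (x : V) : ‖(S n - S m) (T ((S n - S m) (T x)))‖ ≤
      2 * (‖S n (T x) - x‖ + ‖S m (T x) - x‖) := by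
    have h (y : V) : ‖(S n - S m) (T y)‖ ≤ 2 * ‖y‖ := by
      rw [_root_.sub_apply]
      linarith [norm_sub_le (S n (T y)) (S m (T y)), hS.norm_apply_le n y, hS.norm_apply_le m y]
    refine (h _).trans (mul_le_mul_of_nonneg_left ?_ zero_le_two)
    rw [_root_.sub_apply, ← sub_sub_sub_cancel_right _ _ x]
    exact norm_sub_le _ _
  refine (norm_sq_map_prim_le hτ (ι.comp (S n - S m)) hDI c ht hs).trans ?_
  rw [add_le_add_iff_left, ← mul_add, ← integral_add (hi n) (hi m), ← integral_const_mul]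
  refine integral_mono_of_nonneg (ae_of_all _ fun _ => by positivity)
    (((hi n).add (hi m)).const_mul 4) (hW.mono fun r hr => ?_)
  dsimp only
  rw [hr, adjoint_comp_apply hA]
  nlinarith [mul_le_mul_of_nonneg_left (hbound (v r)) (norm_nonneg (D r))]

theorem IsApproxInverse.norm_sq_prim_sub_norm_sq_prim (hτ : 0 ≤ τ)
    (hS : IsApproxInverse (ι.adjoint.comp ι) S) (hD : Integrable D (volume.restrict (Ioo 0 τ)))
    (hW : ∀ᵐ t ∂(volume.restrict (Ioo 0 τ)), prim c D t = ι.adjoint.comp ι (v t)) (n : ℕ) :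
    ‖ι (S n (prim c D τ))‖ ^ 2 - ‖ι (S n (prim c D 0))‖ ^ 2 =
      2 * ∫ t in Ioo 0 τ, ⟪D t, S n (ι.adjoint.comp ι (S n (ι.adjoint.comp ι (v t))))⟫_ℝ := by
  have h := norm_sq_map_prim (ι.comp (S n))
    ((intervalIntegrable_iff_integrableOn_Ioo_of_le hτ).2 hD) c (right_mem_Icc.2 hτ)
  simp only [adjoint_comp_apply (hS.isSelfAdjoint n)] at h
  rw [prim_apply_zero, ← ContinuousLinearMap.comp_apply, h, ContinuousLinearMap.comp_apply,
    add_sub_cancel_left, ← integral_Ioo_eq_intervalIntegral hτ, integral_const_mul]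
  congr 1
  exact integral_congr_ae (hW.mono fun t ht => by dsimp only; rw [ht])

end Regularization

/-- Here `V'` is identified with `V`, so that the embedding of `V` in `V'` becomes `ι†ι`. -/
theorem HasWeakDeriv.exists_continuousOn_norm_sq_sub_norm_sq (hτ : 0 < τ) {ι : V →L[ℝ] H}
    (hι : Function.Injective ι) (hv : MemLp v 2 (volume.restrict (Ioo 0 τ)))
    (hD : MemLp D 2 (volume.restrict (Ioo 0 τ)))
    (h : HasWeakDeriv τ (fun t => ι.adjoint (ι (v t))) D) :
    ∃ w : ℝ → H, ContinuousOn w (Icc 0 τ) ∧ (fun t => ι (v t)) =ᵐ[volume.restrict (Ioo 0 τ)] w ∧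
      ‖w τ‖ ^ 2 - ‖w 0‖ ^ 2 = 2 * ∫ t in Ioo 0 τ, ⟪D t, v t⟫_ℝ := by
  set T := ι.adjoint.comp ι
  have hTinj : Function.Injective T := (ι.adjoint_comp_self_injective_iff).2 hι
  have hDI := hD.integrable one_le_two
  obtain ⟨S, hS⟩ := exists_isApproxInverse ι.isPositive_adjoint_comp_self hTinj
  obtain ⟨c, hc⟩ := h.ae_eq_prim hτ (T.integrable_comp (hv.integrable one_le_two)) hDI
  have hW : ∀ᵐ t ∂(volume.restrict (Ioo 0 τ)), prim c D t = T (v t) := hc.mono fun t ht => ht.symm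
  set w : ℕ → ℝ → H := fun n t => ι (S n (prim c D t))
  have hlim : ∀ᵐ t ∂(volume.restrict (Ioo 0 τ)), Tendsto (fun n => w n t) atTop (𝓝 (ι (v t))) :=
    hW.mono fun t ht => by
      simp only [w, ht]
      exact (ι.continuous.tendsto _).comp (hS.tendsto (v t))
  have hne : (ae (volume.restrict (Ioo 0 τ))).NeBot := by
    rw [ae_neBot, Ne, Measure.restrict_eq_zero, Real.volume_Ioo]
    simpa using hτ
  obtain ⟨s, hs, hsτ⟩ := (hlim.and (ae_restrict_mem measurableSet_Ioo)).exists
  have hcau : UniformCauchySeqOn w atTop (Icc 0 τ) :=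
    uniformCauchySeqOn_of_norm_sub_sq_le hs.cauchySeq
      (by simpa using (hS.tendsto_integral_norm_sub hv hD).const_mul 4) fun n m t ht => by
        simpa [w] using hS.norm_sub_sq_le hτ.le hv hD hW n m ht (Ioo_subset_Icc_self hsτ)
  choose! w' hw' using fun t (ht : t ∈ Icc 0 τ) => cauchySeq_tendsto_of_complete (hcau.cauchySeq ht)
  refine ⟨w', (hcau.tendstoUniformlyOn_of_tendsto hw').continuousOn (Frequently.of_forall fun n =>
    (ι.comp (S n)).continuous.comp_continuousOn (continuousOn_prim hτ.le c
      ((intervalIntegrable_iff_integrableOn_Ioo_of_le hτ.le).2 hDI))), ?_, ?_⟩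
  · filter_upwards [hlim, ae_restrict_mem measurableSet_Ioo] with t ht htτ
    exact tendsto_nhds_unique ht (hw' t (Ioo_subset_Icc_self htτ))
  · have henergy := tendsto_integral_bilin (innerSL ℝ) hD hv.norm
      (fun n => (((S n).comp T).comp ((S n).comp T)).continuous.comp_aestronglyMeasurable hv.1)
      (fun n t => (hS.norm_apply_le n _).trans (hS.norm_apply_le n _))
      (fun t => hS.tendsto_comp (v t))
    refine tendsto_nhds_unique (((hw' τ (right_mem_Icc.2 hτ.le)).norm.pow 2).sub
      ((hw' 0 (left_mem_Icc.2 hτ.le)).norm.pow 2)) ((henergy.const_mul 2).congr fun n => ?_)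
    exact (hS.norm_sq_prim_sub_norm_sq_prim hτ.le hDI hW n).symm

end Energy

/-! ### Real forms and the operators they induce -/

section RealForm

variable {V : Type*} [NormedAddCommGroup V] [InnerProductSpace ℝ V] {τ M : ℝ}

/-- A real non-autonomous form on `(0, τ)` with bound `M`; the real part of a form over `ℝ` or `ℂ`
is of this kind. -/
structure IsRealForm (τ M : ℝ) (b : ℝ → V →ₗ[ℝ] V →ₗ[ℝ] ℝ) : Prop where
  measurable : ∀ v w, AEStronglyMeasurable (fun t => b t v w) (volume.restrict (Ioo 0 τ))
  nonneg : 0 ≤ M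
  bounded : ∀ t ∈ Ioo 0 τ, ∀ v w, |b t v w| ≤ M * ‖v‖ * ‖w‖

omit [InnerProductSpace ℝ V] in
theorem aestronglyMeasurable_linear_apply [NormedSpace ℝ V] {Ω : Type*} [MeasurableSpace Ω]
    {μ : Measure Ω} {β : Ω → V →ₗ[ℝ] ℝ} (hm : ∀ v, AEStronglyMeasurable (fun t => β t v) μ)
    (hc : ∀ᵐ t ∂μ, Continuous (β t)) {u : Ω → V} (hu : AEStronglyMeasurable u μ) :
    AEStronglyMeasurable (fun t => β t (u t)) μ := by
  obtain ⟨u', hu', e⟩ := hu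
  have simple (s : SimpleFunc Ω V) : AEStronglyMeasurable (fun t => β t (s t)) μ := by
    induction s using SimpleFunc.induction with
    | @const c S hS =>
      refine ((hm c).indicator hS).congr (ae_of_all _ fun t => ?_)
      by_cases ht : t ∈ S <;> simp [ht]
    | add _ h1 h2 => exact (h1.add h2).congr (ae_of_all _ fun t => by simp)
  have h : AEStronglyMeasurable (fun t => β t (u' t)) μ := by
    refine aestronglyMeasurable_of_tendsto_ae atTop (fun n => simple (hu'.approx n)) ?_
    filter_upwards [hc] with t ht
    exact (ht.tendsto _).comp (hu'.tendsto_approx t)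
  refine h.congr ?_
  filter_upwards [e] with t ht
  rw [ht]

theorem integral_norm_mul_norm_le {Ω E F : Type*} [MeasurableSpace Ω] {μ : Measure Ω}
    [NormedAddCommGroup E] [NormedAddCommGroup F] (u : Lp E 2 μ) (w : Lp F 2 μ) :
    ∫ t, ‖u t‖ * ‖w t‖ ∂μ ≤ ‖u‖ * ‖w‖ := by
  have h := real_inner_le_norm ((Lp.memLp w).norm.toLp _) ((Lp.memLp u).norm.toLp _)
  rw [L2.inner_def, Lp.norm_toLp, Lp.norm_toLp, eLpNorm_norm, eLpNorm_norm, mul_comm] at h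
  refine le_trans (le_of_eq (integral_congr_ae ?_)) h
  filter_upwards [(Lp.memLp u).norm.coeFn_toLp, (Lp.memLp w).norm.coeFn_toLp] with t hu hw
  rw [hu, hw]
  rfl

variable {b : ℝ → V →ₗ[ℝ] V →ₗ[ℝ] ℝ}

theorem IsRealForm.aestronglyMeasurable (hb : IsRealForm τ M b) {u w : ℝ → V}
    (hu : AEStronglyMeasurable u (volume.restrict (Ioo 0 τ)))
    (hw : AEStronglyMeasurable w (volume.restrict (Ioo 0 τ))) :
    AEStronglyMeasurable (fun t => b t (u t) (w t)) (volume.restrict (Ioo 0 τ)) := by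
  refine aestronglyMeasurable_linear_apply (β := fun t => b t (u t)) (fun x => ?_) ?_ hw
  · refine aestronglyMeasurable_linear_apply (β := fun t => (b t).flip x)
      (fun y => hb.measurable y x) ?_ hu
    filter_upwards [ae_restrict_mem measurableSet_Ioo] with t ht
    exact AddMonoidHomClass.continuous_of_bound _ (M * ‖x‖) fun y => by
      simpa [mul_right_comm] using hb.bounded t ht y x
  · filter_upwards [ae_restrict_mem measurableSet_Ioo] with t ht
    exact AddMonoidHomClass.continuous_of_bound _ (M * ‖u t‖) fun y => hb.bounded t ht _ y

theorem IsRealForm.ae_norm_le (hb : IsRealForm τ M b) (u w : ℝ → V) :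
    ∀ᵐ t ∂(volume.restrict (Ioo 0 τ)), ‖b t (u t) (w t)‖ ≤ M * (‖u t‖ * ‖w t‖) := by
  filter_upwards [ae_restrict_mem measurableSet_Ioo] with t ht
  rw [← mul_assoc]
  exact hb.bounded t ht _ _

theorem IsRealForm.integrable (hb : IsRealForm τ M b) (u w : L2 τ V) :
    Integrable (fun t => b t (u t) (w t)) (volume.restrict (Ioo 0 τ)) :=
  (((Lp.memLp u).norm.integrable_mul (Lp.memLp w).norm).const_mul M).mono'
    (hb.aestronglyMeasurable (Lp.aestronglyMeasurable u) (Lp.aestronglyMeasurable w))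
    (hb.ae_norm_le u w)

/-- The bilinear form `(u, w) ↦ ∫ b(t, u(t), w(t)) dt` on `L²(0, τ; V)`. -/
noncomputable def IsRealForm.integralForm (hb : IsRealForm τ M b) :
    L2 τ V →ₗ[ℝ] L2 τ V →ₗ[ℝ] ℝ :=
  LinearMap.mk₂ ℝ (fun u w => ∫ t in Ioo 0 τ, b t (u t) (w t))
    (fun u u' w => by
      rw [← integral_add (hb.integrable u w) (hb.integrable u' w)]
      refine integral_congr_ae ?_
      filter_upwards [Lp.coeFn_add u u'] with t ht
      rw [ht, Pi.add_apply, map_add, LinearMap.add_apply])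
    (fun c u w => by
      rw [smul_eq_mul, ← integral_const_mul]
      refine integral_congr_ae ?_
      filter_upwards [Lp.coeFn_smul c u] with t ht
      rw [ht, Pi.smul_apply, map_smul, LinearMap.smul_apply, smul_eq_mul])
    (fun u w w' => by
      rw [← integral_add (hb.integrable u w) (hb.integrable u w')]
      refine integral_congr_ae ?_
      filter_upwards [Lp.coeFn_add w w'] with t ht
      rw [ht, Pi.add_apply, map_add])
    (fun c u w => by
      rw [smul_eq_mul, ← integral_const_mul]
      refine integral_congr_ae ?_
      filter_upwards [Lp.coeFn_smul c w] with t ht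
      rw [ht, Pi.smul_apply, map_smul, smul_eq_mul])

theorem IsRealForm.norm_integralForm_le (hb : IsRealForm τ M b) (u w : L2 τ V) :
    ‖hb.integralForm u w‖ ≤ M * ‖u‖ * ‖w‖ :=
  calc ‖∫ t in Ioo 0 τ, b t (u t) (w t)‖ ≤ ∫ t in Ioo 0 τ, M * (‖u t‖ * ‖w t‖) :=
        norm_integral_le_of_norm_le
          (((Lp.memLp u).norm.integrable_mul (Lp.memLp w).norm).const_mul M) (hb.ae_norm_le u w)
    _ ≤ M * ‖u‖ * ‖w‖ := by
        rw [integral_const_mul, mul_assoc]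
        exact mul_le_mul_of_nonneg_left (integral_norm_mul_norm_le u w) hb.nonneg

theorem IsRealForm.exists_operator [CompleteSpace V] (hb : IsRealForm τ M b) :
    ∃ A : L2 τ V →L[ℝ] L2 τ V, ∀ u w : L2 τ V, ⟪A u, w⟫_ℝ = ∫ t in Ioo 0 τ, b t (u t) (w t) :=
  ⟨InnerProductSpace.continuousLinearMapOfBilin (𝕜 := ℝ)
      (hb.integralForm.mkContinuous₂ M hb.norm_integralForm_le : L2 τ V →L[ℝ] L2 τ V →L[ℝ] ℝ),
    InnerProductSpace.continuousLinearMapOfBilin_apply (𝕜 := ℝ) _⟩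

theorem IsRealForm.ae_inner_eq (hb : IsRealForm τ M b) {v G : L2 τ V}
    (h : ∀ w : L2 τ V, ⟪G, w⟫_ℝ = ∫ t in Ioo 0 τ, b t (v t) (w t)) (x : V) :
    ∀ᵐ t ∂(volume.restrict (Ioo 0 τ)), ⟪G t, x⟫_ℝ = b t (v t) x := by
  have hG : Integrable (fun t => ⟪G t, x⟫_ℝ) (volume.restrict (Ioo 0 τ)) :=
    ((Lp.memLp G).integrable one_le_two).inner_const x
  have hv : Integrable (fun t => b t (v t) x) (volume.restrict (Ioo 0 τ)) := by
    refine (((Lp.memLp v).integrable one_le_two).norm.const_mul (M * ‖x‖)).mono'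
      (hb.aestronglyMeasurable (Lp.aestronglyMeasurable v) aestronglyMeasurable_const) ?_
    filter_upwards [hb.ae_norm_le v fun _ => x] with t ht
    linarith
  refine Integrable.ae_eq_of_forall_setIntegral_eq _ _ hG hv fun S hS hμS => ?_
  have e := h (indicatorConstLp 2 hS hμS.ne x)
  rw [L2.inner_def] at e
  rw [← integral_indicator hS, ← integral_indicator hS]
  convert e using 1 <;>
  · refine integral_congr_ae ?_
    filter_upwards [indicatorConstLp_coeFn (p := 2) (hs := hS) (hμs := hμS.ne) (c := x)] with t ht
    rw [ht]
    by_cases hh : t ∈ S <;> simp [hh]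

end RealForm

/-! ### Lions' representation theorem -/

section Representation

variable {Y E F : Type*} [AddCommGroup Y] [Module ℝ Y]

theorem exists_continuousLinearMap_comp_eq [NormedAddCommGroup E] [NormedSpace ℝ E]
    (β : Y →ₗ[ℝ] E) (l : Y →ₗ[ℝ] ℝ) (C : ℝ) (h : ∀ y, |l y| ≤ C * ‖β y‖) :
    ∃ φ : E →L[ℝ] ℝ, ∀ y, φ (β y) = l y := by
  have hl : l ∈ LinearMap.range β.dualMap := by
    rw [LinearMap.range_dualMap_eq_dualAnnihilator_ker, Submodule.mem_dualAnnihilator]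
    intro y hy
    have := h y
    rwa [LinearMap.mem_ker.1 hy, norm_zero, mul_zero, abs_nonpos_iff] at this
  obtain ⟨g, rfl⟩ := hl
  obtain ⟨φ, hφ, -⟩ := exists_extension_norm_eq (LinearMap.range β)
    ((g.domRestrict (LinearMap.range β)).mkContinuous C fun ⟨_, y, hy⟩ => hy ▸ h y)
  exact ⟨φ, fun y => hφ ⟨β y, y, rfl⟩⟩

theorem exists_inner_add_inner_eq [NormedAddCommGroup E] [InnerProductSpace ℝ E] [CompleteSpace E]
    [NormedAddCommGroup F] [InnerProductSpace ℝ F] [CompleteSpace F]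
    (β : Y →ₗ[ℝ] E) (γ : Y →ₗ[ℝ] F) (l : Y →ₗ[ℝ] ℝ) (C : ℝ)
    (h : ∀ y, |l y| ≤ C * max ‖β y‖ ‖γ y‖) :
    ∃ v ξ, ∀ y, ⟪v, β y⟫_ℝ + ⟪ξ, γ y⟫_ℝ = l y := by
  obtain ⟨φ, hφ⟩ := exists_continuousLinearMap_comp_eq (β.prod γ) l C h
  refine ⟨(InnerProductSpace.toDual ℝ E).symm (φ.comp (.inl ℝ E F)),
    (InnerProductSpace.toDual ℝ F).symm (φ.comp (.inr ℝ E F)), fun y => ?_⟩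
  rw [InnerProductSpace.toDual_symm_apply, InnerProductSpace.toDual_symm_apply, ← hφ]
  simp only [ContinuousLinearMap.comp_apply, ContinuousLinearMap.inl_apply,
    ContinuousLinearMap.inr_apply, ← map_add, Prod.mk_add_mk, add_zero, zero_add]
  rfl

end Representation

/-! ### Primitives of functions in `L²(0, τ; V)` -/

section PrimL2

variable {V : Type*} [NormedAddCommGroup V] {τ : ℝ}

theorem memLp_two_of_continuousOn_Icc {f : ℝ → V} (hf : ContinuousOn f (Icc 0 τ)) :
    MemLp f 2 (volume.restrict (Ioo 0 τ)) := by
  obtain ⟨C, hC⟩ := isCompact_Icc.exists_bound_of_continuousOn hf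
  refine MemLp.of_bound ((hf.mono Ioo_subset_Icc_self).aestronglyMeasurable measurableSet_Ioo) C ?_
  filter_upwards [ae_restrict_mem measurableSet_Ioo] with t ht
  exact hC t (Ioo_subset_Icc_self ht)

theorem intervalIntegrable_coeFn (hτ : 0 ≤ τ) (g : L2 τ V) : IntervalIntegrable g volume 0 τ :=
  (intervalIntegrable_iff_integrableOn_Ioo_of_le hτ).2 ((Lp.memLp g).integrable one_le_two)

variable [NormedSpace ℝ V]

theorem prim_congr {c : V} {f g : ℝ → V} (h : f =ᵐ[volume.restrict (Ioo 0 τ)] g) {t : ℝ}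
    (ht : t ∈ Icc 0 τ) : prim c f t = prim c g t := by
  simp only [prim]
  rw [← integral_Ioo_eq_intervalIntegral ht.1, ← integral_Ioo_eq_intervalIntegral ht.1,
    integral_congr_ae (ae_restrict_of_ae_restrict_of_subset (Ioo_subset_Ioo_right ht.2) h)]

theorem prim_coeFn_add (x x' : V) (g g' : L2 τ V) {t : ℝ} (ht : t ∈ Icc 0 τ) :
    prim (x + x') (g + g' : L2 τ V) t = prim x g t + prim x' g' t := by
  have hsub : uIcc 0 t ⊆ uIcc 0 τ := by
    rw [uIcc_of_le ht.1, uIcc_of_le (ht.1.trans ht.2)]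
    exact Icc_subset_Icc_right ht.2
  have hint (g : L2 τ V) : IntervalIntegrable g volume 0 t :=
    (intervalIntegrable_coeFn (ht.1.trans ht.2) g).mono_set hsub
  rw [prim_congr (Lp.coeFn_add g g') ht]
  simp only [prim, Pi.add_apply]
  rw [intervalIntegral.integral_add (hint g) (hint g'), add_add_add_comm]

theorem prim_coeFn_smul (r : ℝ) (x : V) (g : L2 τ V) {t : ℝ} (ht : t ∈ Icc 0 τ) :
    prim (r • x) (r • g : L2 τ V) t = r • prim x g t := by
  rw [prim_congr (Lp.coeFn_smul r g) ht]
  simp only [prim, Pi.smul_apply, intervalIntegral.integral_smul, smul_add]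

theorem memLp_prim (hτ : 0 ≤ τ) (x : V) (g : L2 τ V) :
    MemLp (prim x g) 2 (volume.restrict (Ioo 0 τ)) :=
  memLp_two_of_continuousOn_Icc (continuousOn_prim hτ x (intervalIntegrable_coeFn hτ g))

/-- The function in `H¹(0, τ; V)` with initial value `x` and derivative `g`, as an element of
`L²(0, τ; V)` depending linearly on the pair `(x, g)`. -/
noncomputable def primL2 (hτ : 0 ≤ τ) : V × L2 τ V →ₗ[ℝ] L2 τ V where
  toFun y := (memLp_prim hτ y.1 y.2).toLp
  map_add' y z := by
    rw [← MemLp.toLp_add]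
    refine MemLp.toLp_congr _ _ ?_
    filter_upwards [ae_restrict_mem measurableSet_Ioo] with t ht
    exact prim_coeFn_add _ _ _ _ (Ioo_subset_Icc_self ht)
  map_smul' r y := by
    rw [RingHom.id_apply, ← MemLp.toLp_const_smul]
    refine MemLp.toLp_congr _ _ ?_
    filter_upwards [ae_restrict_mem measurableSet_Ioo] with t ht
    exact prim_coeFn_smul _ _ _ (Ioo_subset_Icc_self ht)

theorem coeFn_primL2 (hτ : 0 ≤ τ) (y : V × L2 τ V) :
    primL2 hτ y =ᵐ[volume.restrict (Ioo 0 τ)] prim y.1 y.2 :=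
  (memLp_prim hτ y.1 y.2).coeFn_toLp

/-- The final value of the function in `H¹(0, τ; V)` with initial value `x` and derivative `g`. -/
noncomputable def primEnd (hτ : 0 ≤ τ) : V × L2 τ V →ₗ[ℝ] V where
  toFun y := prim y.1 y.2 τ
  map_add' _ _ := prim_coeFn_add _ _ _ _ (right_mem_Icc.2 hτ)
  map_smul' _ _ := prim_coeFn_smul _ _ _ (right_mem_Icc.2 hτ)

theorem primEnd_apply (hτ : 0 ≤ τ) (y : V × L2 τ V) : primEnd hτ y = prim y.1 y.2 τ := rfl

theorem exists_primEnd_eq [CompleteSpace V] (hτ : 0 < τ) (x z : V) :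
    ∃ g : L2 τ V, primEnd hτ.le (x, g) = z := by
  have gm : MemLp (fun _ => τ⁻¹ • (z - x)) 2 (volume.restrict (Ioo 0 τ)) := memLp_const _
  refine ⟨gm.toLp, ?_⟩
  rw [primEnd_apply, prim_congr gm.coeFn_toLp (right_mem_Icc.2 hτ.le), prim,
    intervalIntegral.integral_const, sub_zero, smul_inv_smul₀ hτ.ne', add_sub_cancel]

end PrimL2

/-! ### Weak solutions of the real problem -/

section WeakSolution

variable {V : Type*} [NormedAddCommGroup V] [InnerProductSpace ℝ V] [CompleteSpace V]
  {H : Type*} [NormedAddCommGroup H] [InnerProductSpace ℝ H] [CompleteSpace H]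
  {τ M α : ℝ} {b : ℝ → V →ₗ[ℝ] V →ₗ[ℝ] ℝ}

/-- Pointwise application of `ι†ι`, i.e. of the embedding of `V` in `V'` when `V'` is identified
with `V`. -/
noncomputable def gramL2 (τ : ℝ) (ι : V →L[ℝ] H) : L2 τ V →L[ℝ] L2 τ V :=
  (ι.adjoint.comp ι).compLpL 2 (volume.restrict (Ioo 0 τ))

theorem coeFn_gramL2 (ι : V →L[ℝ] H) (v : L2 τ V) :
    gramL2 τ ι v =ᵐ[volume.restrict (Ioo 0 τ)] fun t => ι.adjoint (ι (v t)) :=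
  (ι.adjoint.comp ι).coeFn_compLpL v

theorem inner_gramL2_left (ι : V →L[ℝ] H) (v w : L2 τ V) :
    ⟪gramL2 τ ι v, w⟫_ℝ = ∫ t in Ioo 0 τ, ⟪ι (v t), ι (w t)⟫_ℝ := by
  rw [L2.inner_def]
  refine integral_congr_ae ?_
  filter_upwards [coeFn_gramL2 ι v] with t ht
  rw [ht, ContinuousLinearMap.adjoint_inner_left]

theorem inner_gramL2_comm (ι : V →L[ℝ] H) (v w : L2 τ V) :
    ⟪v, gramL2 τ ι w⟫_ℝ = ⟪gramL2 τ ι v, w⟫_ℝ := by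
  rw [real_inner_comm, inner_gramL2_left, inner_gramL2_left]
  simp only [real_inner_comm]

theorem inner_gramL2_self_le (ι : V →L[ℝ] H) (v : L2 τ V) :
    ⟪gramL2 τ ι v, v⟫_ℝ ≤ ‖ι‖ ^ 2 * ‖v‖ ^ 2 := by
  rw [inner_gramL2_left, ← real_inner_self_eq_norm_sq v, L2.inner_def, ← integral_const_mul]
  have hint := (L2.integrable_inner (𝕜 := ℝ) v v).const_mul (‖ι‖ ^ 2)
  refine integral_mono_of_nonneg (ae_of_all _ fun t => real_inner_self_nonneg) hint
    (ae_of_all _ fun t => ?_)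
  simp only [real_inner_self_eq_norm_sq, ← mul_pow]
  gcongr
  exact ι.le_opNorm _

omit [CompleteSpace V] in
theorem exists_weighted {μ : ℝ} (hμ : 0 ≤ μ) (hμτ : μ * τ ≤ 1) (W : L2 τ V) :
    ∃ Wρ : L2 τ V, (Wρ =ᵐ[volume.restrict (Ioo 0 τ)] fun t => (1 - μ * t) • W t) ∧
      ‖Wρ‖ ≤ ‖W‖ := by
  have hle : ∀ᵐ t ∂(volume.restrict (Ioo 0 τ)), ‖(1 - μ * t) • W t‖ ≤ ‖W t‖ := by
    filter_upwards [ae_restrict_mem measurableSet_Ioo] with t ht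
    rw [norm_smul]
    refine mul_le_of_le_one_left (norm_nonneg _) (abs_le.2 ⟨?_, ?_⟩) <;>
      nlinarith [ht.1, ht.2, mul_le_mul_of_nonneg_left ht.2.le hμ]
  have hm : MemLp (fun t => (1 - μ * t) • W t) 2 (volume.restrict (Ioo 0 τ)) :=
    (Lp.memLp W).of_le ((by fun_prop : Continuous fun t => 1 - μ * t).aestronglyMeasurable.smul
      (Lp.aestronglyMeasurable W)) hle
  refine ⟨hm.toLp, hm.coeFn_toLp, Lp.norm_le_norm_of_ae_le ?_⟩
  filter_upwards [hm.coeFn_toLp, hle] with t h1 h2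
  rwa [h1]

theorem weighted_norm_sq_prim_sub (hτ : 0 < τ) (ι : V →L[ℝ] H) (μ : ℝ) (x : V) {g : ℝ → V}
    (hg : IntervalIntegrable g volume 0 τ) :
    (1 - μ * τ) * ‖ι (prim x g τ)‖ ^ 2 - ‖ι x‖ ^ 2 =
      ∫ t in Ioo 0 τ, (-μ * ‖ι (prim x g t)‖ ^ 2 +
        (1 - μ * t) * (2 * ⟪ι (g t), ι (prim x g t)⟫_ℝ)) := by
  set k : ℝ → ℝ := fun t => 2 * ⟪g t, ι.adjoint (ι (prim x g t))⟫_ℝ with hk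
  have hkI : IntervalIntegrable k volume 0 τ :=
    (intervalIntegrable_bilin (innerSL ℝ) hτ.le hg ((ι.adjoint.comp ι).continuous.comp_continuousOn
      (continuousOn_prim hτ.le x hg))).const_mul 2
  have hnorm (t : ℝ) (ht : t ∈ Icc 0 τ) : prim (‖ι x‖ ^ 2) k t = ‖ι (prim x g t)‖ ^ 2 :=
    (norm_sq_map_prim ι hg x ht).symm
  have hρ (t : ℝ) : prim 1 (fun _ => -μ) t = 1 - μ * t := by
    simp [prim]
    ring
  have key := bilin_prim (ContinuousLinearMap.mul ℝ ℝ) (f := fun _ => -μ)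
    intervalIntegrable_const hkI 1 (‖ι x‖ ^ 2) (right_mem_Icc.2 hτ.le)
  simp only [ContinuousLinearMap.mul_apply', hρ, hnorm τ (right_mem_Icc.2 hτ.le)] at key
  rw [key, prim, one_mul, add_sub_cancel_left, ← integral_Ioo_eq_intervalIntegral hτ.le]
  refine setIntegral_congr_fun measurableSet_Ioo fun t ht => ?_
  simp only [hnorm t (Ioo_subset_Icc_self ht)]
  simp only [hk, ContinuousLinearMap.adjoint_inner_right]

theorem weighted_energy (hτ : 0 < τ) (ι : V →L[ℝ] H) (μ : ℝ) (y : V × L2 τ V) {Wρ : L2 τ V}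
    (hWρ : Wρ =ᵐ[volume.restrict (Ioo 0 τ)] fun t => (1 - μ * t) • primL2 hτ.le y t) :
    (1 - μ * τ) * ‖ι (primEnd hτ.le y)‖ ^ 2 - ‖ι y.1‖ ^ 2 =
      -μ * ⟪gramL2 τ ι (primL2 hτ.le y), primL2 hτ.le y⟫_ℝ + 2 * ⟪gramL2 τ ι y.2, Wρ⟫_ℝ := by
  rw [primEnd_apply, weighted_norm_sq_prim_sub hτ ι μ y.1 (intervalIntegrable_coeFn hτ.le y.2),
    L2.inner_def, L2.inner_def, ← integral_const_mul, ← integral_const_mul,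
    ← integral_add ((L2.integrable_inner _ _).const_mul _) ((L2.integrable_inner _ _).const_mul _)]
  refine integral_congr_ae ?_
  filter_upwards [hWρ, coeFn_gramL2 ι y.2, coeFn_gramL2 ι (primL2 hτ.le y), coeFn_primL2 hτ.le y]
    with t h1 h2 h3 h4
  rw [h1, h2, h3, h4, ContinuousLinearMap.adjoint_inner_left,
    ContinuousLinearMap.adjoint_inner_left, real_inner_self_eq_norm_sq, map_smul,
    real_inner_smul_right]
  ring

theorem IsRealForm.weighted_coercive (hb : IsRealForm τ M b) (hα : 0 ≤ α)
    (hc : ∀ t ∈ Ioo 0 τ, ∀ v, α * ‖v‖ ^ 2 ≤ b t v v) {A : L2 τ V →L[ℝ] L2 τ V}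
    (hA : ∀ u w : L2 τ V, ⟪A u, w⟫_ℝ = ∫ t in Ioo 0 τ, b t (u t) (w t)) {μ : ℝ} (hμ : 0 ≤ μ)
    (hμτ : μ * τ ≤ 1) {W Wρ : L2 τ V}
    (hWρ : Wρ =ᵐ[volume.restrict (Ioo 0 τ)] fun t => (1 - μ * t) • W t) :
    (1 - μ * τ) * α * ‖W‖ ^ 2 ≤ ⟪A.adjoint W, Wρ⟫_ℝ := by
  rw [ContinuousLinearMap.adjoint_inner_left, real_inner_comm, hA, ← real_inner_self_eq_norm_sq,
    L2.inner_def, ← integral_const_mul]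
  refine integral_mono_ae ((L2.integrable_inner _ _).const_mul _) (hb.integrable _ _) ?_
  filter_upwards [hWρ, ae_restrict_mem measurableSet_Ioo] with t h ht
  have hρ : 1 - μ * τ ≤ 1 - μ * t := sub_le_sub_left (mul_le_mul_of_nonneg_left ht.2.le hμ) 1
  rw [h, map_smul, LinearMap.smul_apply, smul_eq_mul, real_inner_self_eq_norm_sq, mul_assoc]
  exact mul_le_mul hρ (hc t ht _) (by positivity) ((sub_nonneg.2 hμτ).trans hρ)

theorem norm_sq_sub_le_norm_sq {Φ : H →L[ℝ] H} (hΦ : ‖Φ‖ ≤ 1) (e x : H) :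
    ‖e‖ ^ 2 - 2 * (‖e - Φ.adjoint x‖ * ‖e‖) ≤ ‖x‖ ^ 2 :=
  calc ‖e‖ ^ 2 - 2 * (‖e - Φ.adjoint x‖ * ‖e‖)
      ≤ ‖e‖ ^ 2 - 2 * ⟪e, e - Φ.adjoint x⟫_ℝ + ‖e - Φ.adjoint x‖ ^ 2 := by
        nlinarith [real_inner_le_norm e (e - Φ.adjoint x), sq_nonneg ‖e - Φ.adjoint x‖]
    _ = ‖Φ.adjoint x‖ ^ 2 := by rw [← norm_sub_sq_real, sub_sub_self]
    _ ≤ ‖x‖ ^ 2 := by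
        gcongr
        simpa using Φ.adjoint.le_of_opNorm_le
          ((ContinuousLinearMap.adjoint.norm_map Φ).trans_le hΦ) x

/-- Testing the adjoint problem for `W` with `(1 - μt)W`: the decay of the weight makes up for the
missing contraction in the boundary condition when `‖Φ‖ = 1`. -/
theorem coercive_estimate_primL2 (hτ : 0 < τ) (ι : V →L[ℝ] H) {Φ : H →L[ℝ] H} (hΦ : ‖Φ‖ ≤ 1)
    (hb : IsRealForm τ M b) (hα : 0 ≤ α) (hc : ∀ t ∈ Ioo 0 τ, ∀ v, α * ‖v‖ ^ 2 ≤ b t v v)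
    {A : L2 τ V →L[ℝ] L2 τ V}
    (hA : ∀ u w : L2 τ V, ⟪A u, w⟫_ℝ = ∫ t in Ioo 0 τ, b t (u t) (w t)) {μ : ℝ} (hμ : 0 ≤ μ)
    (hμτ : μ * τ ≤ 1) (hμα : μ * ‖ι‖ ^ 2 ≤ (1 - μ * τ) * α) (y : V × L2 τ V) :
    (1 - μ * τ) * α / 2 * ‖primL2 hτ.le y‖ ^ 2 + μ * τ / 2 * ‖ι (primEnd hτ.le y)‖ ^ 2 ≤
      ‖-gramL2 τ ι y.2 + A.adjoint (primL2 hτ.le y)‖ * ‖primL2 hτ.le y‖ +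
        ‖ι (primEnd hτ.le y) - Φ.adjoint (ι y.1)‖ * ‖ι (primEnd hτ.le y)‖ := by
  set W := primL2 hτ.le y
  set e := ι (primEnd hτ.le y)
  obtain ⟨Wρ, hWρ, hnorm⟩ := exists_weighted hμ hμτ W
  have henergy : (1 - μ * τ) * ‖e‖ ^ 2 - ‖ι y.1‖ ^ 2 =
      -μ * ⟪gramL2 τ ι W, W⟫_ℝ + 2 * ⟪gramL2 τ ι y.2, Wρ⟫_ℝ := weighted_energy hτ ι μ y hWρ
  have hcoer := hb.weighted_coercive hα hc hA hμ hμτ hWρ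
  have hgram : μ * ⟪gramL2 τ ι W, W⟫_ℝ ≤ (1 - μ * τ) * α * ‖W‖ ^ 2 :=
    calc μ * ⟪gramL2 τ ι W, W⟫_ℝ ≤ μ * (‖ι‖ ^ 2 * ‖W‖ ^ 2) := by
          gcongr
          exact inner_gramL2_self_le ι W
      _ ≤ (1 - μ * τ) * α * ‖W‖ ^ 2 := by
          rw [← mul_assoc]
          gcongr
  have htest := (real_inner_le_norm (-gramL2 τ ι y.2 + A.adjoint W) Wρ).trans
    (mul_le_mul_of_nonneg_left hnorm (norm_nonneg _))
  rw [inner_add_left, inner_neg_left] at htest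
  have hend := norm_sq_sub_le_norm_sq hΦ e (ι y.1)
  linarith

end WeakSolution

section Solution

variable {V : Type*} [NormedAddCommGroup V] [InnerProductSpace ℝ V] [CompleteSpace V]
  {H : Type*} [NormedAddCommGroup H] [InnerProductSpace ℝ H] [CompleteSpace H]
  {τ M α : ℝ} {b : ℝ → V →ₗ[ℝ] V →ₗ[ℝ] ℝ} {ι : V →L[ℝ] H} {Φ : H →L[ℝ] H}

theorem le_mul_max_of_mul_sq_add_sq_le {κ a b p q : ℝ} (hκ : 0 < κ) (ha : 0 ≤ a) (hb : 0 ≤ b)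
    (hp : 0 ≤ p) (h : κ * (a ^ 2 + b ^ 2) ≤ p * a + q * b) : a ≤ 2 / κ * max p q := by
  rcases ha.eq_or_lt with rfl | ha'
  · exact mul_nonneg (div_nonneg two_pos.le hκ.le) (hp.trans (le_max_left p q))
  have hsum : κ * (a + b) * (a + b) ≤ 2 * max p q * (a + b) := by
    nlinarith [mul_le_mul_of_nonneg_right (le_max_left p q) ha,
      mul_le_mul_of_nonneg_right (le_max_right p q) hb, mul_nonneg hκ.le (sq_nonneg (a - b))]
  have := le_of_mul_le_mul_right hsum (by positivity)
  rw [div_mul_eq_mul_div, le_div_iff₀ hκ]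
  nlinarith [mul_nonneg hκ.le hb]

theorem exists_norm_primL2_le (hτ : 0 < τ) (ι : V →L[ℝ] H) (hΦ : ‖Φ‖ ≤ 1)
    (hb : IsRealForm τ M b) (hα : 0 < α) (hc : ∀ t ∈ Ioo 0 τ, ∀ v, α * ‖v‖ ^ 2 ≤ b t v v)
    {A : L2 τ V →L[ℝ] L2 τ V}
    (hA : ∀ u w : L2 τ V, ⟪A u, w⟫_ℝ = ∫ t in Ioo 0 τ, b t (u t) (w t)) :
    ∃ C, ∀ y : V × L2 τ V, ‖primL2 hτ.le y‖ ≤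
      C * max ‖-gramL2 τ ι y.2 + A.adjoint (primL2 hτ.le y)‖
        ‖ι (primEnd hτ.le y) - Φ.adjoint (ι y.1)‖ := by
  set μ : ℝ := α / (‖ι‖ ^ 2 + 1 + α * τ) with hμ
  have hμ0 : 0 < μ := by positivity
  have hμeq : μ * ‖ι‖ ^ 2 + μ + μ * τ * α = α := by
    rw [hμ]
    field_simp
  have hμα : μ * ‖ι‖ ^ 2 ≤ (1 - μ * τ) * α := by linarith
  have hμτ : 0 < 1 - μ * τ := by
    refine pos_of_mul_pos_left (b := α) ?_ hα.le
    nlinarith [mul_nonneg hμ0.le (sq_nonneg ‖ι‖)]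
  set κ : ℝ := min ((1 - μ * τ) * α / 2) (μ * τ / 2)
  have hκ : 0 < κ := by positivity
  refine ⟨2 / κ, fun y => le_mul_max_of_mul_sq_add_sq_le hκ (norm_nonneg _)
    (norm_nonneg (ι (primEnd hτ.le y))) (norm_nonneg _) ?_⟩
  refine le_trans ?_
    (coercive_estimate_primL2 hτ ι hΦ hb hα.le hc hA hμ0.le (sub_pos.1 hμτ).le hμα y)
  rw [mul_add]
  gcongr
  · exact min_le_left _ _
  · exact min_le_right _ _

theorem exists_weak_solution (hτ : 0 < τ) (ι : V →L[ℝ] H) (hΦ : ‖Φ‖ ≤ 1)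
    (hb : IsRealForm τ M b) (hα : 0 < α) (hc : ∀ t ∈ Ioo 0 τ, ∀ v, α * ‖v‖ ^ 2 ≤ b t v v)
    {A : L2 τ V →L[ℝ] L2 τ V}
    (hA : ∀ u w : L2 τ V, ⟪A u, w⟫_ℝ = ∫ t in Ioo 0 τ, b t (u t) (w t)) (F : L2 τ V) :
    ∃ v ξ, ∀ y : V × L2 τ V, ⟪gramL2 τ ι v, y.2⟫_ℝ + ⟪F - A v, primL2 hτ.le y⟫_ℝ =
      ⟪ξ, ι (primEnd hτ.le y)⟫_ℝ - ⟪Φ ξ, ι y.1⟫_ℝ := by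
  obtain ⟨C, hbound⟩ := exists_norm_primL2_le hτ ι hΦ hb hα hc hA
  let β : V × L2 τ V →ₗ[ℝ] L2 τ V :=
    -(gramL2 τ ι : L2 τ V →ₗ[ℝ] L2 τ V) ∘ₗ .snd ℝ V (L2 τ V) +
      (A.adjoint : L2 τ V →ₗ[ℝ] L2 τ V) ∘ₗ primL2 hτ.le
  let γ : V × L2 τ V →ₗ[ℝ] H := (ι : V →ₗ[ℝ] H) ∘ₗ primEnd hτ.le -
    (Φ.adjoint ∘L ι : V →ₗ[ℝ] H) ∘ₗ .fst ℝ V (L2 τ V)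
  obtain ⟨v, ξ, h⟩ := exists_inner_add_inner_eq β γ ((innerₗ (L2 τ V) F) ∘ₗ primL2 hτ.le)
    (‖F‖ * C) fun y => by
      rw [mul_assoc]
      exact (abs_real_inner_le_norm F _).trans
        (mul_le_mul_of_nonneg_left (hbound y) (norm_nonneg F))
  refine ⟨v, ξ, fun y => ?_⟩
  have hy : ⟪v, -gramL2 τ ι y.2 + A.adjoint (primL2 hτ.le y)⟫_ℝ +
      ⟪ξ, ι (primEnd hτ.le y) - Φ.adjoint (ι y.1)⟫_ℝ = ⟪F, primL2 hτ.le y⟫_ℝ := h y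
  rw [inner_add_right, inner_neg_right, inner_sub_right, inner_gramL2_comm,
    ContinuousLinearMap.adjoint_inner_right, ContinuousLinearMap.adjoint_inner_right] at hy
  rw [inner_sub_left]
  linarith

theorem exists_primL2_eq_smul {φ : ℝ → ℝ} (hτ : 0 < τ) (hφ : ContDiff ℝ 1 φ) (h0 : φ 0 = 0)
    (x : V) : ∃ g : L2 τ V, (g =ᵐ[volume.restrict (Ioo 0 τ)] fun t => deriv φ t • x) ∧
      (primL2 hτ.le (0, g) =ᵐ[volume.restrict (Ioo 0 τ)] fun t => φ t • x) ∧
      primEnd hτ.le (0, g) = φ τ • x := by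
  have hd : Continuous (deriv φ) := hφ.continuous_deriv le_rfl
  have hg : MemLp (fun t => deriv φ t • x) 2 (volume.restrict (Ioo 0 τ)) :=
    memLp_two_of_continuousOn_Icc (hd.smul continuous_const).continuousOn
  have hprim (t : ℝ) (ht : t ∈ Icc 0 τ) : prim 0 hg.toLp t = φ t • x := by
    rw [prim_congr hg.coeFn_toLp ht, prim, intervalIntegral.integral_smul_const,
      intervalIntegral.integral_deriv_eq_sub
        (fun s _ => (hφ.differentiable one_ne_zero).differentiableAt)
        (hd.intervalIntegrable _ _), h0, sub_zero, zero_add]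
  refine ⟨hg.toLp, hg.coeFn_toLp, ?_, hprim τ (right_mem_Icc.2 hτ.le)⟩
  filter_upwards [coeFn_primL2 hτ.le ((0 : V), hg.toLp), ae_restrict_mem measurableSet_Ioo]
    with t h ht
  rw [h, hprim t (Ioo_subset_Icc_self ht)]

theorem hasWeakDeriv_of_inner_primL2 (hτ : 0 < τ) {K D : L2 τ V} {ξ ζ : V}
    (h : ∀ y : V × L2 τ V, ⟪K, y.2⟫_ℝ + ⟪D, primL2 hτ.le y⟫_ℝ =
      ⟪ξ, primEnd hτ.le y⟫_ℝ - ⟪ζ, y.1⟫_ℝ) : HasWeakDeriv τ K D := by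
  intro φ hφ hcomp hsupp
  have hK := integrable_smul_L2 (Lp.memLp K) (hφ.continuous_deriv (by simp)) hcomp.deriv
  have hD := integrable_smul_L2 (Lp.memLp D) hφ.continuous hcomp
  rw [eq_neg_iff_add_eq_zero, ← integral_add hK hD]
  refine integral_eq_zero_of_forall_integral_inner_eq_zero ℝ _ (hK.add hD) fun x => ?_
  obtain ⟨g, hg, hprim, hend⟩ := exists_primL2_eq_smul hτ (hφ.of_le (by simp))
    (image_eq_zero_of_notMem_tsupport fun h0 => lt_irrefl _ (hsupp h0).1) x
  have key := h (0, g)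
  rw [hend, image_eq_zero_of_notMem_tsupport fun hτ => lt_irrefl _ (hsupp hτ).2, zero_smul,
    inner_zero_right, inner_zero_right, sub_zero, L2.inner_def, L2.inner_def,
    ← integral_add (L2.integrable_inner _ _) (L2.integrable_inner _ _)] at key
  refine (integral_congr_ae ?_).trans key
  filter_upwards [hg, hprim] with t h1 h2
  simp only [h1, h2, inner_add_right, real_inner_smul_right, real_inner_comm x]

theorem inner_gramL2_add_inner_primL2 (hτ : 0 < τ) {v D : L2 τ V}
    (hvD : HasWeakDeriv τ (gramL2 τ ι v) D) {w : ℝ → H} (hw : ContinuousOn w (Icc 0 τ))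
    (hvw : (fun t => ι (v t)) =ᵐ[volume.restrict (Ioo 0 τ)] w) (y : V × L2 τ V) :
    ⟪gramL2 τ ι v, y.2⟫_ℝ + ⟪D, primL2 hτ.le y⟫_ℝ =
      ⟪w τ, ι (primEnd hτ.le y)⟫_ℝ - ⟪w 0, ι y.1⟫_ℝ := by
  have hDI := intervalIntegrable_coeFn hτ.le D
  obtain ⟨c, hc⟩ := hvD.ae_eq_prim hτ ((Lp.memLp _).integrable one_le_two)
    ((Lp.memLp _).integrable one_le_two)
  have heq : EqOn (prim c D) (fun t => ι.adjoint (w t)) (Icc 0 τ) := by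
    refine Measure.eqOn_Icc_of_ae_eq volume hτ.ne ?_ (continuousOn_prim hτ.le c hDI)
      (ι.adjoint.continuous.comp_continuousOn hw)
    rw [← Measure.restrict_congr_set Ioo_ae_eq_Icc]
    filter_upwards [hc, hvw, coeFn_gramL2 ι v] with t h1 h2 h3
    rw [← h1, h3, h2]
  have h0 : c = ι.adjoint (w 0) := by simpa using heq (left_mem_Icc.2 hτ.le)
  have hend : prim c D τ = ι.adjoint (w τ) := heq (right_mem_Icc.2 hτ.le)
  have hparts : ⟪prim c D τ, primEnd hτ.le y⟫_ℝ = ⟪c, y.1⟫_ℝ +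
      ∫ t in (0 : ℝ)..τ, (⟪D t, prim y.1 y.2 t⟫_ℝ + ⟪prim c D t, y.2 t⟫_ℝ) :=
    bilin_prim (innerSL ℝ) hDI (intervalIntegrable_coeFn hτ.le y.2) c y.1 (right_mem_Icc.2 hτ.le)
  rw [hend, h0, ContinuousLinearMap.adjoint_inner_left, ContinuousLinearMap.adjoint_inner_left,
    ← h0] at hparts
  rw [hparts, add_sub_cancel_left, ← integral_Ioo_eq_intervalIntegral hτ.le, L2.inner_def,
    L2.inner_def, ← integral_add (L2.integrable_inner _ _) (L2.integrable_inner _ _)]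
  refine integral_congr_ae ?_
  filter_upwards [hc, coeFn_primL2 hτ.le y] with t h1 h2
  rw [h1, h2, add_comm]

theorem exists_solution (hτ : 0 < τ) (hι : Function.Injective ι) (hd : DenseRange ι)
    (hΦ : ‖Φ‖ ≤ 1) (hb : IsRealForm τ M b) (hα : 0 < α)
    (hc : ∀ t ∈ Ioo 0 τ, ∀ v, α * ‖v‖ ^ 2 ≤ b t v v) (F : L2 τ V) :
    ∃ (v G : L2 τ V) (w : ℝ → H),
      (∀ x, ∀ᵐ t ∂(volume.restrict (Ioo 0 τ)), ⟪G t, x⟫_ℝ = b t (v t) x) ∧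
      HasWeakDeriv τ (gramL2 τ ι v) (F - G : L2 τ V) ∧
      ContinuousOn w (Icc 0 τ) ∧ (fun t => ι (v t)) =ᵐ[volume.restrict (Ioo 0 τ)] w ∧
      w 0 = Φ (w τ) := by
  obtain ⟨A, hA⟩ := hb.exists_operator
  obtain ⟨v, ξ, hweak⟩ := exists_weak_solution hτ ι hΦ hb hα hc hA F
  have hvD : HasWeakDeriv τ (gramL2 τ ι v) (F - A v : L2 τ V) :=
    hasWeakDeriv_of_inner_primL2 hτ (ξ := ι.adjoint ξ) (ζ := ι.adjoint (Φ ξ)) fun y => by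
      rw [hweak, ContinuousLinearMap.adjoint_inner_left, ContinuousLinearMap.adjoint_inner_left]
  obtain ⟨w, hw, hvw, -⟩ := (hvD.congr (coeFn_gramL2 ι v)
    (ae_eq_refl _)).exists_continuousOn_norm_sq_sub_norm_sq hτ hι (Lp.memLp v) (Lp.memLp _)
  have hbdry (y : V × L2 τ V) : ⟪w τ, ι (primEnd hτ.le y)⟫_ℝ - ⟪w 0, ι y.1⟫_ℝ =
      ⟪ξ, ι (primEnd hτ.le y)⟫_ℝ - ⟪Φ ξ, ι y.1⟫_ℝ :=
    (inner_gramL2_add_inner_primL2 hτ hvD hw hvw y).symm.trans (hweak y)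
  have hend : w τ = ξ := hd.eq_of_inner_left (𝕜 := ℝ) fun x => by
    obtain ⟨g, hg⟩ := exists_primEnd_eq hτ 0 x
    simpa [hg] using hbdry (0, g)
  have hzero : w 0 = Φ ξ := hd.eq_of_inner_left (𝕜 := ℝ) fun x => by
    obtain ⟨g, hg⟩ := exists_primEnd_eq hτ x 0
    simpa [hg] using hbdry (x, g)
  exact ⟨v, A v, w, hb.ae_inner_eq (hA v), hvD, hw, hvw, by rw [hzero, hend]⟩

end Solution

/-! ### Restriction to real scalars -/

section Riesz

variable {𝕜 : Type*} [RCLike 𝕜] {V : Type*} [NormedAddCommGroup V] [InnerProductSpace 𝕜 V]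
  [CompleteSpace V] {τ : ℝ}

theorem toAntiDual_id_bijective :
    Function.Bijective (toAntiDual (ContinuousLinearMap.id 𝕜 V)) := by
  refine ⟨(injective_iff_map_eq_zero _).2 fun x hx => ?_, fun ψ => ?_⟩
  · rw [← inner_self_eq_zero (𝕜 := 𝕜)]
    exact DFunLike.congr_fun hx x
  · let l : V →L[𝕜] 𝕜 := ((starL 𝕜 : 𝕜 ≃L⋆[𝕜] 𝕜) : 𝕜 →L⋆[𝕜] 𝕜).comp ψ
    refine ⟨(InnerProductSpace.toDual 𝕜 V).symm l, ?_⟩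
    ext w
    rw [toAntiDual_apply, ← inner_conj_symm, ContinuousLinearMap.id_apply,
      InnerProductSpace.toDual_symm_apply]
    exact RCLike.conj_conj (ψ w)

/-- The Riesz isomorphism between `V` and the space of bounded antilinear functionals on `V`. -/
noncomputable def rieszAnti (𝕜 V : Type*) [RCLike 𝕜] [NormedAddCommGroup V]
    [InnerProductSpace 𝕜 V] [CompleteSpace V] : V ≃L[𝕜] (V →L⋆[𝕜] 𝕜) :=
  ContinuousLinearEquiv.ofBijective (toAntiDual (ContinuousLinearMap.id 𝕜 V))
    (LinearMap.ker_eq_bot.2 toAntiDual_id_bijective.1)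
    (LinearMap.range_eq_top.2 toAntiDual_id_bijective.2)

theorem rieszAnti_apply (x w : V) : rieszAnti 𝕜 V x w = ⟪w, x⟫_𝕜 := rfl

theorem inner_rieszAnti_symm (ψ : V →L⋆[𝕜] 𝕜) (w : V) : ⟪w, (rieszAnti 𝕜 V).symm ψ⟫_𝕜 = ψ w := by
  rw [← rieszAnti_apply, ContinuousLinearEquiv.apply_symm_apply]

omit [CompleteSpace V] in
theorem IsFormImage.ae_apply {a : ℝ → V →ₗ[𝕜] V →ₗ⋆[𝕜] 𝕜} (ha : IsForm τ a) {v : L2 τ V}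
    {g : L2 τ (V →L⋆[𝕜] 𝕜)} (h : IsFormImage τ a v g) {w : ℝ → V}
    (hw : AEStronglyMeasurable w (volume.restrict (Ioo 0 τ))) :
    ∀ᵐ t ∂(volume.restrict (Ioo 0 τ)), g t (w t) = a t (v t) (w t) := by
  obtain ⟨M, -, hM⟩ := ha.bounded
  obtain ⟨s, ⟨c, hc, hsc⟩, hws⟩ := hw.isSeparable_ae_range
  filter_upwards [(ae_ball_iff hc).2 fun x _ => h x, hws, ae_restrict_mem measurableSet_Ioo]
    with t hgc hs ht
  have hcont : Continuous (a t (v t)) := AddMonoidHomClass.continuous_of_bound _ (M * ‖v t‖)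
    (hM t (Ioo_subset_Icc_self ht) (v t))
  exact (isClosed_eq (g t).continuous hcont).closure_subset_iff.2 hgc (hsc hs)

theorem integrable_apply_L2 (d : L2 τ (V →L⋆[𝕜] 𝕜)) (v : L2 τ V) :
    Integrable (fun t => d t (v t)) (volume.restrict (Ioo 0 τ)) := by
  let R : (V →L⋆[𝕜] 𝕜) →L[𝕜] V := (rieszAnti 𝕜 V).symm
  refine (L2.integrable_inner (𝕜 := 𝕜) v (R.compLp d)).congr ?_
  filter_upwards [R.coeFn_compLp d] with t ht
  rw [ht]
  exact inner_rieszAnti_symm (d t) (v t)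

theorem HasWeakDeriv.map {X Y : Type*} [NormedAddCommGroup X] [NormedSpace 𝕜 X] [NormedSpace ℝ X]
    [NormedAddCommGroup Y] [NormedSpace 𝕜 Y] [NormedSpace ℝ Y] [IsScalarTower ℝ 𝕜 X]
    [IsScalarTower ℝ 𝕜 Y] [CompleteSpace X] [CompleteSpace Y] {u u' : ℝ → X}
    (h : HasWeakDeriv τ u u') (hu : MemLp u 2 (volume.restrict (Ioo 0 τ)))
    (hu' : MemLp u' 2 (volume.restrict (Ioo 0 τ))) (L : X →L[𝕜] Y) :
    HasWeakDeriv τ (fun t => L (u t)) (fun t => L (u' t)) := by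
  intro φ hφ hc hs
  have hL (r : ℝ) (x : X) : r • L x = L (r • x) := by
    rw [← algebraMap_smul 𝕜 r x, map_smul, algebraMap_smul]
  simp only [hL]
  rw [L.integral_comp_comm (integrable_smul_L2 hu (hφ.continuous_deriv (by simp)) hc.deriv),
    L.integral_comp_comm (integrable_smul_L2 hu' hφ.continuous hc), h φ hφ hc hs, map_neg]

end Riesz

theorem TimeBoundary.norm_le {𝕜 : Type*} [RCLike 𝕜] {H : Type*} [NormedAddCommGroup H]
    [NormedSpace 𝕜 H] {τ : ℝ} {Φ : H →L[𝕜] H} (hτ : 0 < τ) (hΦ : ‖Φ‖ ≤ 1) {u : L2 τ H}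
    (hu : TimeBoundary τ Φ u) {w : ℝ → H} (hw : ContinuousOn w (Icc 0 τ))
    (huw : u =ᵐ[volume.restrict (Ioo 0 τ)] w) : ‖w 0‖ ≤ ‖w τ‖ := by
  obtain ⟨z, hz, huz, hzb⟩ := hu
  have heq : EqOn z w (Icc 0 τ) := by
    refine Measure.eqOn_Icc_of_ae_eq volume hτ.ne ?_ hz hw
    rw [← Measure.restrict_congr_set Ioo_ae_eq_Icc]
    exact huz.symm.trans huw
  rw [← heq (left_mem_Icc.2 hτ.le), hzb, heq (right_mem_Icc.2 hτ.le)]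
  simpa using Φ.le_of_opNorm_le hΦ (w τ)

section Restrict

variable {𝕜 : Type*} [RCLike 𝕜]
  {V : Type*} [NormedAddCommGroup V] [InnerProductSpace 𝕜 V] [CompleteSpace V]
  [InnerProductSpace ℝ V] [IsScalarTower ℝ 𝕜 V]
  {H : Type*} [NormedAddCommGroup H] [InnerProductSpace 𝕜 H] [CompleteSpace H]
  [InnerProductSpace ℝ H] [IsScalarTower ℝ 𝕜 H]
  {τ : ℝ} {ι : V →L[𝕜] H} {Φ : H →L[𝕜] H} {a : ℝ → V →ₗ[𝕜] V →ₗ⋆[𝕜] 𝕜}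

theorem rieszAnti_adjoint_restrictScalars (hV : ∀ x y : V, ⟪x, y⟫_ℝ = RCLike.re ⟪x, y⟫_𝕜)
    (hH : ∀ x y : H, ⟪x, y⟫_ℝ = RCLike.re ⟪x, y⟫_𝕜) (ι : V →L[𝕜] H) (x : H) :
    rieszAnti 𝕜 V ((ι.restrictScalars ℝ).adjoint x) = toAntiDual ι x := by
  have hadj : (ι.restrictScalars ℝ).adjoint x = ι.adjoint x := by
    refine ext_inner_left ℝ fun w => ?_
    rw [ContinuousLinearMap.adjoint_inner_right, hV, ContinuousLinearMap.adjoint_inner_right, hH]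
    rfl
  ext w
  rw [hadj, rieszAnti_apply, ContinuousLinearMap.adjoint_inner_right]
  rfl

theorem IsMR.integral_nonneg (hV : ∀ x y : V, ⟪x, y⟫_ℝ = RCLike.re ⟪x, y⟫_𝕜)
    (hH : ∀ x y : H, ⟪x, y⟫_ℝ = RCLike.re ⟪x, y⟫_𝕜) (hτ : 0 < τ) (hι : Function.Injective ι)
    (hΦ : ‖Φ‖ ≤ 1) {u : L2 τ H} {v : L2 τ V} {d : L2 τ (V →L⋆[𝕜] 𝕜)} (h : IsMR τ ι u v d)
    (hu : TimeBoundary τ Φ u) : 0 ≤ ∫ t in Ioo 0 τ, RCLike.re (d t (v t)) := by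
  set ιr : V →L[ℝ] H := ι.restrictScalars ℝ
  let R : (V →L⋆[𝕜] 𝕜) →L[𝕜] V := (rieszAnti 𝕜 V).symm
  have hvD : HasWeakDeriv τ (fun t => ιr.adjoint (ιr (v t))) (fun t => R (d t)) := by
    refine (h.deriv.map ((toAntiDual ι).comp_memLp' (Lp.memLp u)) (Lp.memLp d) R).congr ?_
      (ae_eq_refl _)
    filter_upwards [h.emb] with t ht
    rw [ht, ← rieszAnti_adjoint_restrictScalars hV hH]
    exact (rieszAnti 𝕜 V).symm_apply_apply _
  have hRd : MemLp (fun t => R (d t)) 2 (volume.restrict (Ioo 0 τ)) :=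
    R.comp_memLp' (Lp.memLp d)
  obtain ⟨w, hw, hvw, henergy⟩ :=
    hvD.exists_continuousOn_norm_sq_sub_norm_sq hτ hι (Lp.memLp v) hRd
  have hnorm : ‖w 0‖ ^ 2 ≤ ‖w τ‖ ^ 2 :=
    pow_le_pow_left₀ (norm_nonneg _) (hu.norm_le hτ hΦ hw (h.emb.trans hvw)) 2
  have hinner (t : ℝ) : ⟪R (d t), v t⟫_ℝ = RCLike.re (d t (v t)) := by
    rw [real_inner_comm, hV]
    exact congrArg RCLike.re (inner_rieszAnti_symm (d t) (v t))
  have hint : ∫ t in Ioo 0 τ, ⟪R (d t), v t⟫_ℝ = ∫ t in Ioo 0 τ, RCLike.re (d t (v t)) :=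
    integral_congr_ae (ae_of_all _ hinner)
  linarith

theorem graphC_re_inner_nonneg (hV : ∀ x y : V, ⟪x, y⟫_ℝ = RCLike.re ⟪x, y⟫_𝕜)
    (hH : ∀ x y : H, ⟪x, y⟫_ℝ = RCLike.re ⟪x, y⟫_𝕜) (hτ : 0 < τ) (hι : Function.Injective ι)
    (hΦ : ‖Φ‖ ≤ 1) (ha : IsForm τ a) (hre : ∀ t ∈ Icc 0 τ, ∀ v, 0 ≤ RCLike.re (a t v v))
    {u f : L2 τ H} (h : (u, f) ∈ graphC τ ι a Φ) : 0 ≤ RCLike.re ⟪u, f⟫_𝕜 := by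
  obtain ⟨⟨v, d, g, hmr, hg, hdg⟩, hu⟩ := h
  have hint : RCLike.re ⟪u, f⟫_𝕜 = ∫ t in Ioo 0 τ, RCLike.re ⟪u t, f t⟫_𝕜 := by
    rw [L2.inner_def]
    exact (integral_re (L2.integrable_inner u f)).symm
  rw [hint]
  refine (hmr.integral_nonneg hV hH hτ hι hΦ hu).trans
    (integral_mono_ae (integrable_apply_L2 d v).re (L2.integrable_inner u f).re ?_)
  filter_upwards [hmr.emb, hdg, hg.ae_apply ha (Lp.aestronglyMeasurable v),
    ae_restrict_mem measurableSet_Ioo] with t hut hdgt hgt ht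
  have hsplit : ⟪u t, f t⟫_𝕜 = d t (v t) + a t (v t) (v t) := by
    rw [hut, ← toAntiDual_apply, ← hdgt, ← hgt]
    rfl
  rw [hsplit, map_add]
  exact le_add_of_nonneg_right (hre t (Ioo_subset_Icc_self ht) (v t))

/-- The real part of a sesquilinear form, as a real bilinear form. -/
noncomputable def reForm (a : V →ₗ[𝕜] V →ₗ⋆[𝕜] 𝕜) : V →ₗ[ℝ] V →ₗ[ℝ] ℝ :=
  LinearMap.mk₂ ℝ (fun v w => RCLike.re (a v w))
    (fun v v' w => by rw [map_add, LinearMap.add_apply, map_add])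
    (fun r v w => by
      rw [← algebraMap_smul 𝕜 r v, map_smul, LinearMap.smul_apply]
      exact RCLike.re_ofReal_mul _ _)
    (fun v w w' => by rw [map_add, map_add])
    (fun r v w => by
      rw [← algebraMap_smul 𝕜 r w, map_smulₛₗ, RCLike.algebraMap_eq_ofReal, RCLike.conj_ofReal]
      exact RCLike.re_ofReal_mul _ _)

omit [CompleteSpace V] in
theorem reForm_apply (a : V →ₗ[𝕜] V →ₗ⋆[𝕜] 𝕜) (v w : V) : reForm a v w = RCLike.re (a v w) := rfl

omit [CompleteSpace V] in
theorem IsForm.exists_isRealForm (ha : IsForm τ a) :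
    ∃ M, IsRealForm τ M fun t => reForm (a t) := by
  obtain ⟨M, hM0, hM⟩ := ha.bounded
  exact ⟨M, fun v w => (RCLike.continuous_re.measurable.comp_aemeasurable
      ((ha.measurable v w).mono_measure
        (Measure.restrict_mono Ioo_subset_Icc_self le_rfl))).aestronglyMeasurable, hM0,
    fun t ht v w => (RCLike.abs_re_le_norm _).trans (hM t (Ioo_subset_Icc_self ht) v w)⟩

omit [CompleteSpace V] [InnerProductSpace ℝ V] [IsScalarTower ℝ 𝕜 V] in
theorem eq_of_re_eq {ψ χ : V →ₗ⋆[𝕜] 𝕜} {x : V} (h : RCLike.re (ψ x) = RCLike.re (χ x))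
    (hI : RCLike.re (ψ ((RCLike.I : 𝕜) • x)) = RCLike.re (χ ((RCLike.I : 𝕜) • x))) :
    ψ x = χ x :=
  RCLike.ext h (by simpa using hI)

theorem exists_mem_graphC (hV : ∀ x y : V, ⟪x, y⟫_ℝ = RCLike.re ⟪x, y⟫_𝕜)
    (hH : ∀ x y : H, ⟪x, y⟫_ℝ = RCLike.re ⟪x, y⟫_𝕜) (hτ : 0 < τ) (hι : Function.Injective ι)
    (hd : DenseRange ι) (hΦ : ‖Φ‖ ≤ 1) (ha : IsForm τ a) (hc : IsCoercive τ a) (f : L2 τ H) :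
    ∃ u : L2 τ H, (u, f) ∈ graphC τ ι a Φ := by
  set ιr : V →L[ℝ] H := ι.restrictScalars ℝ
  let R : V →L[𝕜] (V →L⋆[𝕜] 𝕜) := rieszAnti 𝕜 V
  have hR (x : H) : R (ιr.adjoint x) = toAntiDual ι x :=
    rieszAnti_adjoint_restrictScalars hV hH ι x
  obtain ⟨M, hb⟩ := ha.exists_isRealForm
  obtain ⟨α, hα, hcα⟩ := hc
  set F : L2 τ V := ιr.adjoint.compLp f
  obtain ⟨v, G, w, hG, hvD, hw, hvw, hwb⟩ := exists_solution hτ (ι := ιr) hι hd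
    (Φ := Φ.restrictScalars ℝ) (by simpa using hΦ) hb hα
    (fun t ht => hcα t (Ioo_subset_Icc_self ht)) F
  have hu : (ι.compLp v : ℝ → H) =ᵐ[volume.restrict (Ioo 0 τ)] fun t => ι (v t) :=
    ι.coeFn_compLp v
  refine ⟨ι.compLp v, ⟨v, R.compLp (F - G), R.compLp G, ⟨hu, ?_⟩, fun x => ?_, ?_⟩,
    w, hw, hu.trans hvw, hwb⟩
  · refine (hvD.map (Lp.memLp _) (Lp.memLp _) R).congr ?_
      (EventuallyEq.symm (R.coeFn_compLp (F - G)))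
    filter_upwards [hu, coeFn_gramL2 ιr v] with t h1 h2
    rw [h1, h2, hR]
    rfl
  · filter_upwards [R.coeFn_compLp G, hG x, hG ((RCLike.I : 𝕜) • x)] with t h1 h2 h3
    rw [h1]
    rw [real_inner_comm, hV, reForm_apply] at h2 h3
    exact eq_of_re_eq (ψ := (R (G t) : V →ₗ⋆[𝕜] 𝕜)) h2 h3
  · filter_upwards [R.coeFn_compLp (F - G), R.coeFn_compLp G, Lp.coeFn_sub F G,
      ιr.adjoint.coeFn_compLp f] with t h1 h2 h3 h4
    rw [h1, h2, h3, Pi.sub_apply, ← map_add, sub_add_cancel, h4, hR]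

end Restrict

/-! ### Accretive forms -/

section Shift

variable {𝕜 : Type*} [RCLike 𝕜]
  {V : Type*} [NormedAddCommGroup V] [InnerProductSpace 𝕜 V]
  {H : Type*} [NormedAddCommGroup H] [InnerProductSpace 𝕜 H]
  {τ l : ℝ} {ι : V →L[𝕜] H} {Φ : H →L[𝕜] H} {a : ℝ → V →ₗ[𝕜] V →ₗ⋆[𝕜] 𝕜}

/-- The form `a(t, v, w) + l (v | w)_H`, which is associated with the operators `l + 𝒜(t)`. -/
noncomputable def shiftForm (ι : V →L[𝕜] H) (l : ℝ) (a : ℝ → V →ₗ[𝕜] V →ₗ⋆[𝕜] 𝕜) :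
    ℝ → V →ₗ[𝕜] V →ₗ⋆[𝕜] 𝕜 :=
  fun t => a t + (l : 𝕜) • ((toAntiDual ι).comp ι).toLinearMap₁₂

theorem shiftForm_apply (t : ℝ) (v w : V) :
    shiftForm ι l a t v w = a t v w + l * ⟪ι w, ι v⟫_𝕜 := rfl

theorem re_shiftForm_self (t : ℝ) (v : V) :
    RCLike.re (shiftForm ι l a t v v) = RCLike.re (a t v v) + l * ‖ι v‖ ^ 2 := by
  rw [shiftForm_apply, map_add, RCLike.re_ofReal_mul, inner_self_eq_norm_sq]

theorem IsForm.zero : IsForm τ (0 : ℝ → V →ₗ[𝕜] V →ₗ⋆[𝕜] 𝕜) where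
  measurable _ _ := aemeasurable_const
  bounded := ⟨0, le_rfl, fun _ _ _ _ => by simp⟩

theorem IsForm.shiftForm (ha : IsForm τ a) : IsForm τ (shiftForm ι l a) where
  measurable v w := (ha.measurable v w).add_const _
  bounded := by
    obtain ⟨M, hM0, hM⟩ := ha.bounded
    refine ⟨M + |l| * ‖ι‖ ^ 2, by positivity, fun t ht v w => ?_⟩
    calc ‖a t v w + l * ⟪ι w, ι v⟫_𝕜‖ ≤ ‖a t v w‖ + ‖(l * ⟪ι w, ι v⟫_𝕜 : 𝕜)‖ := norm_add_le _ _
      _ ≤ M * ‖v‖ * ‖w‖ + |l| * ((‖ι‖ * ‖w‖) * (‖ι‖ * ‖v‖)) := by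
        rw [norm_mul, RCLike.norm_ofReal]
        gcongr
        · exact hM t ht v w
        · exact (norm_inner_le_norm _ _).trans
            (mul_le_mul (ι.le_opNorm w) (ι.le_opNorm v) (norm_nonneg _) (by positivity))
      _ = (M + |l| * ‖ι‖ ^ 2) * ‖v‖ * ‖w‖ := by ring

theorem IsCoercive.shiftForm (hc : IsCoercive τ a) (hl : 0 ≤ l) :
    IsCoercive τ (shiftForm ι l a) := by
  obtain ⟨α, hα, h⟩ := hc
  refine ⟨α, hα, fun t ht v => (h t ht v).trans ?_⟩
  rw [re_shiftForm_self]
  exact le_add_of_nonneg_right (by positivity)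

theorem re_nonneg_of_isCoercive_shiftForm (h : ∀ l > 0, IsCoercive τ (shiftForm ι l a)) {t : ℝ}
    (ht : t ∈ Icc 0 τ) (v : V) : 0 ≤ RCLike.re (a t v v) := by
  have hlim : Tendsto (fun l : ℝ => RCLike.re (a t v v) + l * ‖ι v‖ ^ 2) (𝓝[>] 0)
      (𝓝 (RCLike.re (a t v v))) :=
    ((by fun_prop : Continuous fun l : ℝ => RCLike.re (a t v v) + l * ‖ι v‖ ^ 2).tendsto' 0 _
      (by simp)).mono_left nhdsWithin_le_nhds
  refine ge_of_tendsto hlim (eventually_mem_nhdsWithin.mono fun l hl => ?_)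
  obtain ⟨α, hα, hαl⟩ := h l hl
  rw [← re_shiftForm_self]
  exact (by positivity : 0 ≤ α * ‖v‖ ^ 2).trans (hαl t ht v)

theorem mem_graphC_of_mem_graphC_shiftForm {u f : L2 τ H}
    (h : (u, f) ∈ graphC τ ι (shiftForm ι l a) Φ) : (u, f - (l : 𝕜) • u) ∈ graphC τ ι a Φ := by
  obtain ⟨⟨v, d, g, hmr, hg, hdg⟩, hu⟩ := h
  set k : L2 τ (V →L⋆[𝕜] 𝕜) := (toAntiDual ι).compLp u
  have hk : ∀ᵐ t ∂(volume.restrict (Ioo 0 τ)), (g - (l : 𝕜) • k) t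
      = g t - (l : 𝕜) • toAntiDual ι (u t) := by
    filter_upwards [Lp.coeFn_sub g ((l : 𝕜) • k), Lp.coeFn_smul (l : 𝕜) k,
      (toAntiDual ι).coeFn_compLp u] with t h1 h2 h3
    rw [h1, Pi.sub_apply, h2, Pi.smul_apply, h3]
  refine ⟨⟨v, d, g - (l : 𝕜) • k, hmr, fun w => ?_, ?_⟩, hu⟩
  · filter_upwards [hk, hg w, hmr.emb] with t h1 h2 h3
    rw [h1, _root_.sub_apply, _root_.smul_apply, h2, h3, shiftForm_apply, toAntiDual_apply,
      smul_eq_mul, add_sub_cancel_right]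
  · filter_upwards [hk, hdg, Lp.coeFn_sub f ((l : 𝕜) • u), Lp.coeFn_smul (l : 𝕜) u]
      with t h1 h2 h3 h4
    rw [h1, h3, Pi.sub_apply, h4, Pi.smul_apply, map_sub, map_smul, ← h2, add_sub_assoc]

end Shift

section Accretive

variable {𝕜 : Type*} [RCLike 𝕜]

theorem isMAccretive_of_graph {X : Type*} [NormedAddCommGroup X] [InnerProductSpace 𝕜 X]
    {A : X →ₗ.[𝕜] X} (hre : ∀ x y : X, (x, y) ∈ A.graph → 0 ≤ RCLike.re ⟪x, y⟫_𝕜)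
    (hsurj : ∀ l : ℝ, 0 < l → ∀ f : X, ∃ x : X, (x, f - (l : 𝕜) • x) ∈ A.graph) :
    IsMAccretive A where
  accretive x t ht := by
    have hsq : ‖(x : X)‖ * ‖(x : X)‖ ≤ ‖(x : X)‖ * ‖(x : X) + (t : 𝕜) • A x‖ :=
      calc ‖(x : X)‖ * ‖(x : X)‖
          ≤ ‖(x : X)‖ * ‖(x : X)‖ + t * RCLike.re ⟪(x : X), A x⟫_𝕜 :=
            le_add_of_nonneg_right (mul_nonneg ht.le (hre x (A x) (A.mem_graph x)))
        _ = RCLike.re ⟪(x : X), (x : X) + (t : 𝕜) • A x⟫_𝕜 := by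
            rw [inner_add_right, inner_smul_right, map_add, RCLike.re_ofReal_mul,
              inner_self_eq_norm_mul_norm]
        _ ≤ ‖(x : X)‖ * ‖(x : X) + (t : 𝕜) • A x‖ := re_inner_le_norm _ _
    rcases (norm_nonneg (x : X)).eq_or_lt with hx | hx
    · rw [← hx]
      exact norm_nonneg _
    · exact le_of_mul_le_mul_left hsq hx
  surjective l hl f := by
    obtain ⟨x, hx⟩ := hsurj l hl f
    obtain ⟨y, rfl, hy⟩ := A.mem_graph_iff.1 hx
    exact ⟨y, by rw [hy, add_sub_cancel]⟩

variable {H : Type*} [NormedAddCommGroup H] [InnerProductSpace 𝕜 H] [CompleteSpace H] {τ : ℝ}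
  {Φ : H →L[𝕜] H}

theorem isMAccretive_opC (hτ : 0 < τ) (hΦ : ‖Φ‖ ≤ 1) {V : Type*} [NormedAddCommGroup V]
    [InnerProductSpace 𝕜 V] [CompleteSpace V] {ι : V →L[𝕜] H} (hι : Function.Injective ι)
    (hd : DenseRange ι) {a : ℝ → V →ₗ[𝕜] V →ₗ⋆[𝕜] 𝕜} (ha : IsForm τ a)
    (hc : ∀ l > 0, IsCoercive τ (shiftForm ι l a)) : IsMAccretive (opC τ ι a Φ) := by
  let _ : InnerProductSpace ℝ H := InnerProductSpace.rclikeToReal 𝕜 H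
  let _ : InnerProductSpace ℝ V := InnerProductSpace.rclikeToReal 𝕜 V
  have : IsScalarTower ℝ 𝕜 H := RestrictScalars.isScalarTower ℝ 𝕜 H
  have : IsScalarTower ℝ 𝕜 V := RestrictScalars.isScalarTower ℝ 𝕜 V
  have hV (x y : V) : ⟪x, y⟫_ℝ = RCLike.re ⟪x, y⟫_𝕜 := rfl
  have hH (x y : H) : ⟪x, y⟫_ℝ = RCLike.re ⟪x, y⟫_𝕜 := rfl
  refine isMAccretive_of_graph ?_ ?_ <;> rw [graph_opC hι hd]
  · exact fun u f => graphC_re_inner_nonneg hV hH hτ hι hΦ ha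
      fun t ht v => re_nonneg_of_isCoercive_shiftForm hc ht v
  · intro l hl f
    obtain ⟨u, hu⟩ := exists_mem_graphC hV hH hτ hι hd hΦ ha.shiftForm (hc l hl) f
    exact ⟨u, mem_graphC_of_mem_graphC_shiftForm hu⟩

theorem graphB_eq_graphC (τ : ℝ) (Φ : H →L[𝕜] H) :
    graphB τ Φ = graphC τ (ContinuousLinearMap.id 𝕜 H) 0 Φ := by
  let _ : NormedSpace ℝ H := NormedSpace.restrictScalars ℝ 𝕜 H
  have : IsScalarTower ℝ 𝕜 H := RestrictScalars.isScalarTower ℝ 𝕜 H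
  let T : H →L[𝕜] (H →L⋆[𝕜] 𝕜) := toAntiDual (ContinuousLinearMap.id 𝕜 H)
  let R : (H →L⋆[𝕜] 𝕜) →L[𝕜] H := (rieszAnti 𝕜 H).symm
  have hRT (x : H) : R (T x) = x := (rieszAnti 𝕜 H).symm_apply_apply x
  have hzero := Lp.coeFn_zero (H →L⋆[𝕜] 𝕜) 2 (volume.restrict (Ioo 0 τ))
  ext ⟨u, f⟩
  refine and_congr_left' ⟨fun h => ?_, ?_⟩
  · refine ⟨u, T.compLp f, 0, ⟨ae_eq_refl _, ?_⟩, fun w => ?_, ?_⟩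
    · exact (HasWeakDeriv.map h (Lp.memLp u) (Lp.memLp f) T).congr (ae_eq_refl _)
        (EventuallyEq.symm (T.coeFn_compLp f))
    · filter_upwards [hzero] with t ht
      rw [ht]
      rfl
    · filter_upwards [hzero, T.coeFn_compLp f] with t h1 h2
      rw [h1, h2, Pi.zero_apply, add_zero]
  · rintro ⟨v, d, g, hmr, hg, hdg⟩
    have hg0 : ∀ᵐ t ∂(volume.restrict (Ioo 0 τ)), g t = 0 := by
      filter_upwards [hg.ae_apply IsForm.zero
        (R.continuous.comp_aestronglyMeasurable (Lp.aestronglyMeasurable g))] with t ht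
      refine (rieszAnti 𝕜 H).symm.map_eq_zero_iff.1 (inner_self_eq_zero (𝕜 := 𝕜).1 ?_)
      rw [inner_rieszAnti_symm]
      exact ht
    refine (hmr.deriv.map (T.comp_memLp' (Lp.memLp u)) (Lp.memLp d) R).congr
      (ae_of_all _ fun t => hRT (u t)) ?_
    filter_upwards [hdg, hg0] with t h1 h2
    rw [h2, add_zero] at h1
    rw [h1]
    exact hRT (f t)

theorem isMAccretive_opB (hτ : 0 < τ) (hΦ : ‖Φ‖ ≤ 1) : IsMAccretive (opB τ Φ) := by
  have hBC : opB τ Φ = opC τ (ContinuousLinearMap.id 𝕜 H) 0 Φ :=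
    congrArg Submodule.toLinearPMap (graphB_eq_graphC τ Φ)
  rw [hBC]
  refine isMAccretive_opC hτ hΦ Function.injective_id denseRange_id
    IsForm.zero fun l hl => ⟨l, hl, fun t _ v => ?_⟩
  rw [re_shiftForm_self]
  simp

end Accretive

end TimeBVP

theorem theorem5p8_general {𝕜 : Type*} [RCLike 𝕜]
    {H : Type*} [NormedAddCommGroup H] [InnerProductSpace 𝕜 H] [CompleteSpace H]
    (τ : ℝ) (hτ : 0 < τ) (Φ : H →L[𝕜] H) (hΦ : ‖Φ‖ ≤ 1) :
    (∀ (V : Type*) [NormedAddCommGroup V] [InnerProductSpace 𝕜 V] [CompleteSpace V]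
      (ι : V →L[𝕜] H), Function.Injective ι → DenseRange ι →
      ∀ a : ℝ → V →ₗ[𝕜] V →ₗ⋆[𝕜] 𝕜, TimeBVP.IsForm τ a →
        (∀ l > 0, TimeBVP.IsCoercive τ (TimeBVP.shiftForm ι l a)) →
        TimeBVP.IsMAccretive (TimeBVP.opC τ ι a Φ)) ∧
    TimeBVP.IsMAccretive (TimeBVP.opB τ Φ) :=
  ⟨fun _ _ _ _ _ hι hd _ ha hc => TimeBVP.isMAccretive_opC hτ hΦ hι hd ha hc,
    TimeBVP.isMAccretive_opB hτ hΦ⟩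

theorem theorem5p8 {𝕜 : Type*} [RCLike 𝕜]
    {H : Type*} [NormedAddCommGroup H] [InnerProductSpace 𝕜 H] [CompleteSpace H]
    (τ : ℝ) (hτ : 0 < τ) (Φ : H →L[𝕜] H) (hΦ : ‖Φ‖ ≤ 1) :
    (∀ (V : Type*) [NormedAddCommGroup V] [InnerProductSpace 𝕜 V] [CompleteSpace V]
      (ι : V →L[𝕜] H), Function.Injective ι → DenseRange ι →
      ∀ a : ℝ → V →ₗ[𝕜] V →ₗ⋆[𝕜] 𝕜, TimeBVP.IsForm τ a → TimeBVP.IsCoercive τ a →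
        TimeBVP.IsMAccretive (TimeBVP.opC τ ι a Φ)) ∧
    TimeBVP.IsMAccretive (TimeBVP.opB τ Φ) :=
  (theorem5p8_general τ hτ Φ hΦ).imp_left fun h V _ _ _ ι hι hd a ha hc =>
    h V ι hι hd a ha fun _ hl => hc.shiftForm hl.le
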